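/- All algebras are unital and all morphisms and inclusions are unit preserving. Fix a countably saturated nonstandard extension $X\mapsto{}^\bullet X$ of the standard universe (that is, a map satisfying the transfer principle, for which ${}^\bullet\mathbb N$ has unlimited elements and every sequence $(x_n)_{n\in\mathbb N}$ of elements of a set ${}^\bullet X$ extends to an internal sequence indexed by ${}^\bullet\mathbb N$). Definitions. Let $\mathfrak B$ be a hyperfinite dimensional $C^*$-algebra, i.e. a member of the extension of a standard family of finite dimensional $C^*$-algebras. Its infinitesimal hull is the quotient of $\{x\in\mathfrak B:\|x\|\text{ is limited}\}$, an algebra over $\mathbb C$ with involution, by the ideal $\{x:\|x\|\text{ is infinitesimal}\}$. For a finite dimensional (or, by transfer, hyperfinite dimensional) $C^*$-algebra $A$ let $\min A$ be its set of minimal nonzero central projections; for $e\in\min A$ let $\dim(e)$ be the number $n$ with $Ae\cong M_n(\mathbb C)$ (respectively $M_n({}^\bullet\mathbb C)$). The dimension vector of $A$ is the (internal) family $\overline{\dim}(A)=(\dim e)_{e\in\min A}$. An inclusion matrix is an internal matrix of nonnegative hyperintegers, with given (hyperfinite) row and column index sets, that has no zero row and no zero column. A dimension vector $\bar m$ divides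 a dimension vector $\bar n$, written $\bar m\mid\bar n$, if $\bar n=\Gamma\bar m$ for some inclusion matrix $\Gamma$. Proposition. Let $\mathbf A$ be a $C^*$-algebra and let $\mathbf A_0\subseteq\mathbf A_1\subseteq\cdots$ be finite dimensional $C^*$-subalgebras of $\mathbf A$ (containing the unit of $\mathbf A$) with $\mathbf A=\overline{\bigcup_i\mathbf A_i}$. Let $\mathfrak B$ be a hyperfinite dimensional $C^*$-algebra. Then there is an injective $C^*$-algebra morphism (unital $*$-homomorphism) from $\mathbf A$ into the infinitesimal hull of $\mathfrak B$ if and only if $\overline{\dim}(\mathbf A_i)\mid\overline{\dim}(\mathfrak B)$ for every $i\in\mathbb N$. In particular, if $\mathbf A_i\cong M_{n_i}(\mathbb C)$ for all $i$ (so $\mathbf A$ is a UHF algebra) and $\mathfrak B$ is a full internal matrix algebra of size $N\in{}^\bullet\mathbb N$, $N\ge 1$, i.e. $\mathfrak B$ is internally $*$-isomorphic to $M_N({}^\bullet\mathbb C)$, then $\mathbf A$ embeds injectively into the infinitesimal hull of $\mathfrak B$ if and only if $n_i\mid N$ in ${}^\bullet\mathbb N$ for every $i$. -/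

import Mathlib

universe u v

/-- A (countably saturated) nonstandard extension of the standard universe: it assigns to every
standard set `X` its extension `Ext X` (the set `•X`), to every standard `x ∈ X` the element
`std x` (the element `•x`), and to every standard map `f : X → Y` its extension
`map f : •X → •Y`.

The *transfer principle* is expressed by the fields from `map_id` to `prop_cases`. A standard
relation `R` on `X` has the extension `•R = {x ∈ •X | map R x = std True}` (see `Holds`), and these
fields say exactly that `•` respects the formation of first-order statements: substitution
(functoriality), free variables (`•(X × Y) = •X × •Y`) and truth values (`•{True, False}` has the
two elements `•True ≠ •False`). The clauses of transfer for `¬`, `∧`, `=`, `∃` are derived below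
(`holds_std`, `holds_not`, `holds_and`, `holds_eq`, `holds_exists`); sets, functions and families
are covered because `X` may be `Set Y`, `Y → Z`, `Σ t, B t`, and so on. Internal objects are the
elements of the extensions `•X`. -/
structure NonstandardExtension where
  Ext : Type → Type u
  std : ∀ {X : Type}, X → Ext X
  map : ∀ {X Y : Type}, (X → Y) → Ext X → Ext Y
  pair : ∀ {X Y : Type}, Ext X → Ext Y → Ext (X × Y)
  map_id : ∀ {X : Type} (x : Ext X), map (fun a => a) x = x
  map_comp : ∀ {X Y Z : Type} (g : Y → Z) (f : X → Y) (x : Ext X),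
    map g (map f x) = map (fun a => g (f a)) x
  map_std : ∀ {X Y : Type} (f : X → Y) (a : X), map f (std a) = std (f a)
  unit_eq : ∀ x : Ext Unit, x = std ()
  map_fst_pair : ∀ {X Y : Type} (x : Ext X) (y : Ext Y), map Prod.fst (pair x y) = x
  map_snd_pair : ∀ {X Y : Type} (x : Ext X) (y : Ext Y), map Prod.snd (pair x y) = y
  pair_eta : ∀ {X Y : Type} (z : Ext (X × Y)), pair (map Prod.fst z) (map Prod.snd z) = z
  true_ne_false : std True ≠ std False
  prop_cases : ∀ p : Ext Prop, p = std True ∨ p = std False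
  /-- There is an unlimited hyperinteger. -/
  exists_unlimited : ∃ N : Ext ℕ, ∀ n : ℕ, N ≠ std n
  /-- Countable saturation: every sequence of internal elements of `•X` is the restriction to `ℕ`
  of an internal sequence indexed by `•ℕ`, i.e. of an element of `•(ℕ → X)`. -/
  saturation : ∀ {X : Type} (s : ℕ → Ext X),
    ∃ g : Ext (ℕ → X), ∀ n : ℕ, map (fun h => h n) g = s n

namespace NonstandardExtension

variable (M : NonstandardExtension.{u})

/-- `M.Holds P x`: the internal point `x ∈ •X` belongs to the extension of `{a ∈ X | P a}`. -/
def Holds {X : Type} (P : X → Prop) (x : M.Ext X) : Prop := M.map P x = M.std True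

section Transfer

variable {M} {X Y Z : Type}

theorem map_const (c : Y) (x : M.Ext X) : M.map (fun _ => c) x = M.std c := by
  have h := M.map_comp (fun _ : Unit => c) (fun _ : X => ()) x
  rw [← h, M.unit_eq (M.map _ x), M.map_std]

theorem prod_ext {z w : M.Ext (X × Y)} (h₁ : M.map Prod.fst z = M.map Prod.fst w)
    (h₂ : M.map Prod.snd z = M.map Prod.snd w) : z = w := by
  rw [← M.pair_eta z, ← M.pair_eta w, h₁, h₂]

theorem pair_map (f : X → Y) (g : X → Z) (x : M.Ext X) :
    M.pair (M.map f x) (M.map g x) = M.map (fun a => (f a, g a)) x := by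
  apply prod_ext
  · rw [M.map_fst_pair, M.map_comp]
  · rw [M.map_snd_pair, M.map_comp]

theorem pair_std (a : X) (b : Y) : M.pair (M.std a) (M.std b) = M.std (a, b) := by
  apply prod_ext
  · rw [M.map_fst_pair, M.map_std]
  · rw [M.map_snd_pair, M.map_std]

theorem holds_std (P : X → Prop) (a : X) : M.Holds P (M.std a) ↔ P a := by
  unfold Holds
  rw [M.map_std]
  by_cases h : P a
  · simp [h]
  · simp [h, M.true_ne_false.symm]

theorem holds_map (P : Y → Prop) (f : X → Y) (x : M.Ext X) :
    M.Holds P (M.map f x) ↔ M.Holds (fun a => P (f a)) x := by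
  unfold Holds
  rw [M.map_comp]

theorem holds_not (P : X → Prop) (x : M.Ext X) : M.Holds (fun a => ¬ P a) x ↔ ¬ M.Holds P x := by
  unfold Holds
  rw [← M.map_comp (fun p : Prop => ¬ p) P x]
  rcases M.prop_cases (M.map P x) with h | h
  · rw [h, M.map_std]
    simp [M.true_ne_false.symm]
  · rw [h, M.map_std]
    simp [M.true_ne_false.symm]

theorem holds_and (P Q : X → Prop) (x : M.Ext X) :
    M.Holds (fun a => P a ∧ Q a) x ↔ M.Holds P x ∧ M.Holds Q x := by
  unfold Holds
  have h := M.map_comp (fun p : Prop × Prop => p.1 ∧ p.2) (fun a => (P a, Q a)) x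
  rw [← h, ← pair_map]
  rcases M.prop_cases (M.map P x) with h₁ | h₁ <;> rcases M.prop_cases (M.map Q x) with h₂ | h₂ <;>
    rw [h₁, h₂, pair_std, M.map_std] <;> simp [M.true_ne_false.symm]

theorem map_eq_of_holds {f g : X → Y} {x : M.Ext X} (h : M.Holds (fun a => f a = g a) x) :
    M.map f x = M.map g x := by
  classical
  let k : Prop × (Y × Y) → Y := fun q => if q.1 then q.2.2 else q.2.1
  have hf : f = fun a => k (f a = g a, (f a, g a)) := by
    funext a
    by_cases h' : f a = g a <;> simp [k, h']
  have hg : g = fun a => k (True, (f a, g a)) := by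
    funext a
    simp [k]
  have e : M.map (fun a => (f a = g a, (f a, g a))) x = M.map (fun a => (True, (f a, g a))) x := by
    rw [← pair_map (fun a => f a = g a) (fun a => (f a, g a)),
      ← pair_map (fun _ => True) (fun a => (f a, g a)), map_const]
    exact congrArg (fun p => M.pair p _) h
  calc M.map f x = M.map k (M.map (fun a => (f a = g a, (f a, g a))) x) := by
        rw [M.map_comp]; exact congrArg (fun F => M.map F x) hf
    _ = M.map k (M.map (fun a => (True, (f a, g a))) x) := by rw [e]
    _ = M.map g x := by rw [M.map_comp]; exact congrArg (fun F => M.map F x) hg.symm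

theorem holds_eq (f g : X → Y) (x : M.Ext X) :
    M.Holds (fun a => f a = g a) x ↔ M.map f x = M.map g x := by
  refine ⟨map_eq_of_holds, fun h => ?_⟩
  have h₁ := M.map_comp (fun p : Y × Y => p.1 = p.2) (fun a => (f a, g a)) x
  have h₂ := M.map_comp (fun p : Y × Y => p.1 = p.2) (fun a => (f a, f a)) x
  unfold Holds
  rw [← h₁, ← pair_map, ← h, pair_map, h₂]
  simp only
  exact map_const True x

theorem holds_of_forall {P : X → Prop} (h : ∀ a, P a) (x : M.Ext X) : M.Holds P x := by
  have : P = fun _ => True := funext fun a => eq_true (h a)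
  subst this
  exact map_const True x

theorem Holds.mono {P Q : X → Prop} {x : M.Ext X} (hP : M.Holds P x) (h : ∀ a, P a → Q a) :
    M.Holds Q x := by
  have h' : M.Holds (fun a => P a ∧ Q a) x := by
    have : (fun a => P a ∧ Q a) = P := funext fun a => propext ⟨fun q => q.1, fun p => ⟨p, h a p⟩⟩
    rw [this]
    exact hP
  exact ((holds_and P Q x).1 h').2

theorem Holds.mono₂ {P Q R : X → Prop} {x : M.Ext X} (hP : M.Holds P x) (hQ : M.Holds Q x)
    (h : ∀ a, P a → Q a → R a) : M.Holds R x :=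
  ((holds_and P Q x).2 ⟨hP, hQ⟩).mono fun a p => h a p.1 p.2

theorem Holds.exists_of {P : X → Prop} {x : M.Ext X} (h : M.Holds P x) : ∃ a, P a := by
  by_contra hn
  push Not at hn
  exact (holds_not P x).1 (holds_of_forall hn x) h

theorem holds_exists (R : X → Y → Prop) (x : M.Ext X) :
    M.Holds (fun a => ∃ b, R a b) x ↔
      ∃ y : M.Ext Y, M.Holds (fun p : X × Y => R p.1 p.2) (M.pair x y) := by
  constructor
  · intro h
    obtain ⟨a₀, b₀, -⟩ := h.exists_of
    classical
    let g : X → Y := fun a => if h : ∃ b, R a b then h.choose else b₀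
    refine ⟨M.map g x, ?_⟩
    have e : M.pair x (M.map g x) = M.map (fun a => (a, g a)) x := by
      rw [← pair_map, M.map_id]
    rw [e, holds_map]
    refine h.mono fun a ha => ?_
    simp only [g, dif_pos ha]
    exact ha.choose_spec
  · rintro ⟨y, hy⟩
    have h := hy.mono (Q := fun p => ∃ b, R p.1 b) fun p hp => ⟨p.2, hp⟩
    rwa [← holds_map (fun a => ∃ b, R a b) Prod.fst, M.map_fst_pair] at h

theorem map_injective {f : X → Y} (hf : Function.Injective f) :
    Function.Injective (M.map f) := by
  intro x y h
  obtain ⟨a₀, -⟩ := (holds_of_forall (P := fun _ : X => True) (fun _ => trivial) x).exists_of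
  have : Nonempty X := ⟨a₀⟩
  have e : ∀ z : M.Ext X, M.map (Function.invFun f) (M.map f z) = z := by
    intro z
    rw [M.map_comp]
    have : (fun a => Function.invFun f (f a)) = fun a => a :=
      funext fun a => Function.leftInverse_invFun hf a
    rw [this, M.map_id]
  rw [← e x, ← e y, h]

/-- The points of `•X` over which a relation holds are the points of the extension of the
corresponding standard subset. -/
theorem exists_subtype {P : X → Prop} {x : M.Ext X} (h : M.Holds P x) :
    ∃ y : M.Ext {a // P a}, M.map Subtype.val y = x := by
  classical
  obtain ⟨a₀, h₀⟩ := h.exists_of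
  let r : X → {a // P a} := fun a => if h : P a then ⟨a, h⟩ else ⟨a₀, h₀⟩
  refine ⟨M.map r x, ?_⟩
  rw [M.map_comp]
  conv_rhs => rw [← M.map_id x]
  refine map_eq_of_holds (h.mono fun a ha => ?_)
  simp [r, ha]

end Transfer

/-! ### Hyperintegers -/

section Hypernat

/-- The extension `•f : •X × •Y → •Z` of a standard map of two variables. -/
def map₂ {X Y Z : Type} (f : X → Y → Z) (x : M.Ext X) (y : M.Ext Y) : M.Ext Z :=
  M.map (fun p => f p.1 p.2) (M.pair x y)

variable {M}

theorem map₂_map {W X Y Z : Type} (f : X → Y → Z) (g : W → X) (h : W → Y) (w : M.Ext W) :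
    M.map₂ f (M.map g w) (M.map h w) = M.map (fun a => f (g a) (h a)) w := by
  unfold map₂
  rw [pair_map, M.map_comp]

theorem exists_rep₃ {X Y Z : Type} (x : M.Ext X) (y : M.Ext Y) (z : M.Ext Z) :
    ∃ w : M.Ext (X × Y × Z), x = M.map (fun a => a.1) w ∧ y = M.map (fun a => a.2.1) w ∧
      z = M.map (fun a => a.2.2) w := by
  refine ⟨M.pair x (M.pair y z), (M.map_fst_pair _ _).symm, ?_, ?_⟩
  · rw [← M.map_comp Prod.fst Prod.snd, M.map_snd_pair, M.map_fst_pair]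
  · rw [← M.map_comp Prod.snd Prod.snd, M.map_snd_pair, M.map_snd_pair]

noncomputable instance : Zero (M.Ext ℕ) := ⟨M.std 0⟩
noncomputable instance : One (M.Ext ℕ) := ⟨M.std 1⟩
noncomputable instance : Add (M.Ext ℕ) := ⟨M.map₂ fun a b => a + b⟩
noncomputable instance : Mul (M.Ext ℕ) := ⟨M.map₂ fun a b => a * b⟩

/-- The hyperintegers `•ℕ` with the extended operations. -/
noncomputable instance : CommSemiring (M.Ext ℕ) where
  nsmul := nsmulRec
  add_assoc x y z := by
    obtain ⟨w, rfl, rfl, rfl⟩ := exists_rep₃ x y z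
    change M.map₂ _ (M.map₂ _ _ _) _ = M.map₂ _ _ (M.map₂ _ _ _)
    simp only [map₂_map, add_assoc]
  zero_add x := by
    have h : M.map₂ (fun a b => a + b) (M.map (fun _ => 0) x) (M.map (fun a => a) x) = x := by
      rw [map₂_map]
      simp only [zero_add, M.map_id]
    rwa [map_const, M.map_id] at h
  add_zero x := by
    have h : M.map₂ (fun a b => a + b) (M.map (fun a => a) x) (M.map (fun _ => 0) x) = x := by
      rw [map₂_map]
      simp only [add_zero, M.map_id]
    rwa [map_const, M.map_id] at h
  add_comm x y := by
    obtain ⟨w, rfl, rfl, -⟩ := exists_rep₃ x y y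
    change M.map₂ _ _ _ = M.map₂ _ _ _
    simp only [map₂_map, add_comm]
  left_distrib x y z := by
    obtain ⟨w, rfl, rfl, rfl⟩ := exists_rep₃ x y z
    change M.map₂ _ _ (M.map₂ _ _ _) = M.map₂ _ (M.map₂ _ _ _) (M.map₂ _ _ _)
    simp only [map₂_map, mul_add]
  right_distrib x y z := by
    obtain ⟨w, rfl, rfl, rfl⟩ := exists_rep₃ x y z
    change M.map₂ _ (M.map₂ _ _ _) _ = M.map₂ _ (M.map₂ _ _ _) (M.map₂ _ _ _)
    simp only [map₂_map, add_mul]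
  zero_mul x := by
    have h : M.map₂ (fun a b => a * b) (M.map (fun _ => 0) x) (M.map (fun a => a) x) = M.std 0 := by
      rw [map₂_map]
      simp only [zero_mul, map_const]
    rwa [map_const, M.map_id] at h
  mul_zero x := by
    have h : M.map₂ (fun a b => a * b) (M.map (fun a => a) x) (M.map (fun _ => 0) x) = M.std 0 := by
      rw [map₂_map]
      simp only [mul_zero, map_const]
    rwa [map_const, M.map_id] at h
  mul_assoc x y z := by
    obtain ⟨w, rfl, rfl, rfl⟩ := exists_rep₃ x y z
    change M.map₂ _ (M.map₂ _ _ _) _ = M.map₂ _ _ (M.map₂ _ _ _)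
    simp only [map₂_map, mul_assoc]
  one_mul x := by
    have h : M.map₂ (fun a b => a * b) (M.map (fun _ => 1) x) (M.map (fun a => a) x) = x := by
      rw [map₂_map]
      simp only [one_mul, M.map_id]
    rwa [map_const, M.map_id] at h
  mul_one x := by
    have h : M.map₂ (fun a b => a * b) (M.map (fun a => a) x) (M.map (fun _ => 1) x) = x := by
      rw [map₂_map]
      simp only [mul_one, M.map_id]
    rwa [map_const, M.map_id] at h
  mul_comm x y := by
    obtain ⟨w, rfl, rfl, -⟩ := exists_rep₃ x y y
    change M.map₂ _ _ _ = M.map₂ _ _ _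
    simp only [map₂_map, mul_comm]

end Hypernat

/-! ### Internal members of a standard family -/

/-- Let `(B t)_{t ∈ T}` be a standard family of sets. Its extension is an internal family indexed by
`•T`; `M.Fiber B τ` is its member at `τ ∈ •T`, the set of the points of `•(Σ t, B t)` over `τ`. -/
def Fiber {T : Type} (B : T → Type) (τ : M.Ext T) : Type u :=
  {x : M.Ext (Σ t, B t) // M.map Sigma.fst x = τ}

section Fiber

variable {M} {T : Type} {B C D E : T → Type} {τ : M.Ext T}

/-- The extension, at `τ`, of a family of maps `B t → C t`. -/
def fmap (f : ∀ t, B t → C t) (x : M.Fiber B τ) : M.Fiber C τ :=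
  ⟨M.map (fun p => ⟨p.1, f p.1 p.2⟩) x.1, by rw [M.map_comp]; exact x.2⟩

/-- The value at `τ` of the extension of a section `s`. -/
def fconst (s : ∀ t, B t) : M.Fiber B τ :=
  ⟨M.map (fun t => ⟨t, s t⟩) τ, by rw [M.map_comp]; exact M.map_id τ⟩

/-- The statement `P`, about points of `B t`, holds at `x`. -/
def FHolds (P : ∀ t, B t → Prop) (x : M.Fiber B τ) : Prop := M.Holds (fun p => P p.1 p.2) x.1

theorem fmap_id (x : M.Fiber B τ) : fmap (fun _ a => a) x = x := Subtype.ext (M.map_id _)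

theorem fmap_fmap (g : ∀ t, C t → D t) (f : ∀ t, B t → C t) (x : M.Fiber B τ) :
    fmap g (fmap f x) = fmap (fun t a => g t (f t a)) x := Subtype.ext (M.map_comp _ _ _)

theorem fconst_eq (s : ∀ t, C t) (x : M.Fiber B τ) :
    fconst s = fmap (fun t _ => s t) x := by
  apply Subtype.ext
  change M.map _ τ = M.map _ x.1
  conv_lhs => rw [← x.2]
  rw [M.map_comp]

theorem exists_fpair (x : M.Fiber B τ) (y : M.Fiber C τ) :
    ∃ w : M.Fiber (fun t => B t × C t) τ,
      fmap (fun _ a => a.1) w = x ∧ fmap (fun _ a => a.2) w = y := by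
  have h : M.Holds (fun p : (Σ t, B t) × (Σ t, C t) => p.1.1 = p.2.1) (M.pair x.1 y.1) := by
    rw [holds_eq, ← M.map_comp Sigma.fst Prod.fst, ← M.map_comp Sigma.fst Prod.snd,
      M.map_fst_pair, M.map_snd_pair, x.2, y.2]
  obtain ⟨q, hq⟩ := exists_subtype h
  have h₁ : M.map (fun p => p.1.1) q = x.1 := by
    rw [← M.map_comp Prod.fst Subtype.val, hq, M.map_fst_pair]
  have h₂ : M.map (fun p => p.1.2) q = y.1 := by
    rw [← M.map_comp Prod.snd Subtype.val, hq, M.map_snd_pair]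
  let k : {p : (Σ t, B t) × (Σ t, C t) // p.1.1 = p.2.1} → Σ t, B t × C t :=
    fun p => ⟨p.1.1.1, p.1.1.2, p.2 ▸ p.1.2.2⟩
  refine ⟨⟨M.map k q, ?_⟩, Subtype.ext ?_, Subtype.ext ?_⟩
  · rw [M.map_comp, ← x.2, ← h₁, M.map_comp]
  · exact (M.map_comp _ _ _).trans h₁
  · refine ((M.map_comp _ _ _).trans (congrArg (fun F => M.map F q) (funext ?_))).trans h₂
    rintro ⟨⟨⟨t, a⟩, ⟨t', b⟩⟩, h⟩
    dsimp only at h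
    subst h
    rfl

theorem fiber_ext {z w : M.Fiber (fun t => B t × C t) τ}
    (h₁ : fmap (fun _ a => a.1) z = fmap (fun _ a => a.1) w)
    (h₂ : fmap (fun _ a => a.2) z = fmap (fun _ a => a.2) w) : z = w := by
  apply Subtype.ext
  let j : (Σ t, B t × C t) → (Σ t, B t) × (Σ t, C t) := fun p => (⟨p.1, p.2.1⟩, ⟨p.1, p.2.2⟩)
  have hj : Function.Injective j := by
    rintro ⟨t, a, b⟩ ⟨t', a', b'⟩ h
    simp only [j, Prod.mk.injEq, Sigma.mk.injEq] at h
    obtain ⟨⟨rfl, h₁⟩, -, h₂⟩ := h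
    rw [eq_of_heq h₁, eq_of_heq h₂]
  apply map_injective hj
  apply prod_ext
  · rw [M.map_comp, M.map_comp]
    exact congrArg Subtype.val h₁
  · rw [M.map_comp, M.map_comp]
    exact congrArg Subtype.val h₂

/-- The pair of two internal points over `τ`. -/
noncomputable def fpair (x : M.Fiber B τ) (y : M.Fiber C τ) : M.Fiber (fun t => B t × C t) τ :=
  (exists_fpair x y).choose

/-- The extension, at `τ`, of a family of maps of two variables. -/
noncomputable def fmap₂ (f : ∀ t, B t → C t → D t) (x : M.Fiber B τ) (y : M.Fiber C τ) :
    M.Fiber D τ :=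
  fmap (fun t a => f t a.1 a.2) (fpair x y)

theorem fpair_fmap (f : ∀ t, B t → C t) (g : ∀ t, B t → D t) (w : M.Fiber B τ) :
    fpair (fmap f w) (fmap g w) = fmap (fun t a => (f t a, g t a)) w := by
  obtain ⟨h₁, h₂⟩ := (exists_fpair (fmap f w) (fmap g w)).choose_spec
  apply fiber_ext
  · rw [fmap_fmap]
    exact h₁
  · rw [fmap_fmap]
    exact h₂

theorem fmap₂_fmap (f : ∀ t, B t → C t → D t) (g : ∀ t, E t → B t) (h : ∀ t, E t → C t)
    (w : M.Fiber E τ) :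
    fmap₂ f (fmap g w) (fmap h w) = fmap (fun t a => f t (g t a) (h t a)) w := by
  unfold fmap₂
  rw [fpair_fmap, fmap_fmap]

theorem exists_frep₂ (x : M.Fiber B τ) (y : M.Fiber C τ) :
    ∃ w : M.Fiber (fun t => B t × C t) τ,
      x = fmap (fun _ a => a.1) w ∧ y = fmap (fun _ a => a.2) w := by
  obtain ⟨w, h₁, h₂⟩ := exists_fpair x y
  exact ⟨w, h₁.symm, h₂.symm⟩

theorem exists_frep₃ (x : M.Fiber B τ) (y : M.Fiber C τ) (z : M.Fiber D τ) :
    ∃ w : M.Fiber (fun t => B t × C t × D t) τ, x = fmap (fun _ a => a.1) w ∧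
      y = fmap (fun _ a => a.2.1) w ∧ z = fmap (fun _ a => a.2.2) w := by
  obtain ⟨v, rfl, rfl⟩ := exists_frep₂ y z
  obtain ⟨w, rfl, rfl⟩ := exists_frep₂ x v
  exact ⟨w, rfl, fmap_fmap _ _ _, fmap_fmap _ _ _⟩

theorem fholds_fmap (P : ∀ t, C t → Prop) (f : ∀ t, B t → C t) (x : M.Fiber B τ) :
    FHolds P (fmap f x) ↔ FHolds (fun t a => P t (f t a)) x := holds_map _ _ _

/-- The value `g(f) ∈ •Y` of an internal family `g`, indexed by the internal set `M.Fiber J τ`, at an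
index `f`. -/
noncomputable def eval {J : T → Type} {Y : Type} (g : M.Fiber (fun t => J t → Y) τ)
    (f : M.Fiber J τ) : M.Ext Y :=
  M.map (fun p => p.2.1 p.2.2) (fpair g f).1

end Fiber

/-! ### Internal C⋆-algebras and their infinitesimal hulls -/

section Hull

variable {M} {T : Type} {B : T → Type} [∀ t, CStarAlgebra (B t)] {τ : M.Ext T}

noncomputable instance : Zero (M.Fiber B τ) := ⟨fconst fun _ => 0⟩
noncomputable instance : One (M.Fiber B τ) := ⟨fconst fun _ => 1⟩
noncomputable instance : Add (M.Fiber B τ) := ⟨fmap₂ fun _ a b => a + b⟩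
noncomputable instance : Mul (M.Fiber B τ) := ⟨fmap₂ fun _ a b => a * b⟩
noncomputable instance : Neg (M.Fiber B τ) := ⟨fmap fun _ a => -a⟩
noncomputable instance : Star (M.Fiber B τ) := ⟨fmap fun _ a => star a⟩
noncomputable instance : SMul ℂ (M.Fiber B τ) := ⟨fun c => fmap fun _ a => c • a⟩

variable {E : T → Type}

theorem fzero_eq (w : M.Fiber E τ) : (0 : M.Fiber B τ) = fmap (fun _ _ => 0) w := fconst_eq _ w

theorem fone_eq (w : M.Fiber E τ) : (1 : M.Fiber B τ) = fmap (fun _ _ => 1) w := fconst_eq _ w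

theorem fadd_eq (g h : ∀ t, E t → B t) (w : M.Fiber E τ) :
    fmap g w + fmap h w = fmap (fun t a => g t a + h t a) w := fmap₂_fmap _ _ _ _

theorem fmul_eq (g h : ∀ t, E t → B t) (w : M.Fiber E τ) :
    fmap g w * fmap h w = fmap (fun t a => g t a * h t a) w := fmap₂_fmap _ _ _ _

theorem fneg_eq (g : ∀ t, E t → B t) (w : M.Fiber E τ) :
    -fmap g w = fmap (fun t a => -g t a) w := fmap_fmap _ _ _

theorem fstar_eq (g : ∀ t, E t → B t) (w : M.Fiber E τ) :
    star (fmap g w) = fmap (fun t a => star (g t a)) w := fmap_fmap _ _ _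

theorem fsmul_eq (c : ℂ) (g : ∀ t, E t → B t) (w : M.Fiber E τ) :
    c • fmap g w = fmap (fun t a => c • g t a) w := fmap_fmap _ _ _

/-- The internal C⋆-algebra `M.Fiber B τ`, the member at `τ` of the extension of a standard family
of C⋆-algebras, with its extended operations. -/
noncomputable instance : Ring (M.Fiber B τ) :=
  Ring.ofMinimalAxioms
    (fun x y z => by
      obtain ⟨w, rfl, rfl, rfl⟩ := exists_frep₃ x y z
      simp only [fadd_eq, add_assoc])
    (fun x => by
      rw [← fmap_id x, fzero_eq x]
      simp only [fadd_eq, zero_add])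
    (fun x => by
      rw [← fmap_id x, fzero_eq x]
      simp only [fadd_eq, fneg_eq, neg_add_cancel])
    (fun x y z => by
      obtain ⟨w, rfl, rfl, rfl⟩ := exists_frep₃ x y z
      simp only [fmul_eq, mul_assoc])
    (fun x => by
      rw [← fmap_id x, fone_eq x]
      simp only [fmul_eq, one_mul])
    (fun x => by
      rw [← fmap_id x, fone_eq x]
      simp only [fmul_eq, mul_one])
    (fun x y z => by
      obtain ⟨w, rfl, rfl, rfl⟩ := exists_frep₃ x y z
      simp only [fadd_eq, fmul_eq, mul_add])
    (fun x y z => by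
      obtain ⟨w, rfl, rfl, rfl⟩ := exists_frep₃ x y z
      simp only [fadd_eq, fmul_eq, add_mul])

noncomputable instance : StarRing (M.Fiber B τ) where
  star_involutive x := by
    rw [← fmap_id x]
    simp only [fstar_eq, star_star]
  star_mul x y := by
    obtain ⟨w, rfl, rfl⟩ := exists_frep₂ x y
    simp only [fstar_eq, fmul_eq, star_mul]
  star_add x y := by
    obtain ⟨w, rfl, rfl⟩ := exists_frep₂ x y
    simp only [fstar_eq, fadd_eq, star_add]

noncomputable instance : Module ℂ (M.Fiber B τ) where
  one_smul x := by
    rw [← fmap_id x]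
    simp only [fsmul_eq, one_smul]
  mul_smul c d x := by
    rw [← fmap_id x]
    simp only [fsmul_eq, mul_smul]
  smul_zero c := by
    rw [fzero_eq (0 : M.Fiber B τ)]
    simp only [fsmul_eq, smul_zero]
  smul_add c x y := by
    obtain ⟨w, rfl, rfl⟩ := exists_frep₂ x y
    simp only [fsmul_eq, fadd_eq, smul_add]
  add_smul c d x := by
    rw [← fmap_id x]
    simp only [fsmul_eq, fadd_eq, add_smul]
  zero_smul x := by
    rw [← fmap_id x, fzero_eq x]
    simp only [fsmul_eq, zero_smul]

noncomputable instance : Algebra ℂ (M.Fiber B τ) :=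
  Algebra.ofModule
    (fun c x y => by
      obtain ⟨w, rfl, rfl⟩ := exists_frep₂ x y
      simp only [fsmul_eq, fmul_eq, smul_mul_assoc])
    (fun c x y => by
      obtain ⟨w, rfl, rfl⟩ := exists_frep₂ x y
      simp only [fsmul_eq, fmul_eq, mul_smul_comm])

instance : StarModule ℂ (M.Fiber B τ) where
  star_smul c x := by
    rw [← fmap_id x]
    simp only [fsmul_eq, fstar_eq, star_smul]

/-- `‖x‖ ≤ r`, for the internal norm of `x` and a standard real number `r`. -/
def NormLE (x : M.Fiber B τ) (r : ℝ) : Prop := FHolds (fun _ a => ‖a‖ ≤ r) x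

/-- `x` has limited norm: `‖x‖ ≪ ∞`. -/
def IsLimited (x : M.Fiber B τ) : Prop := ∃ r : ℝ, NormLE x r

/-- `x` has infinitesimal norm: `‖x‖ ≅ 0`. -/
def IsInfinitesimal (x : M.Fiber B τ) : Prop := ∀ r : ℝ, 0 < r → NormLE x r

theorem normLE_zero {r : ℝ} (hr : 0 ≤ r) : NormLE (0 : M.Fiber B τ) r := by
  rw [fzero_eq (0 : M.Fiber B τ)]
  exact (fholds_fmap _ _ _).2 (holds_of_forall (fun _ => by simpa using hr) _)

theorem normLE_add {x y : M.Fiber B τ} {r s : ℝ} (hx : NormLE x r) (hy : NormLE y s) :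
    NormLE (x + y) (r + s) := by
  obtain ⟨w, rfl, rfl⟩ := exists_frep₂ x y
  rw [fadd_eq]
  refine (fholds_fmap _ _ _).2 (((fholds_fmap _ _ _).1 hx).mono₂ ((fholds_fmap _ _ _).1 hy) ?_)
  intro a h₁ h₂
  exact (norm_add_le _ _).trans (add_le_add h₁ h₂)

theorem normLE_mul {x y : M.Fiber B τ} {r s : ℝ} (hx : NormLE x r) (hy : NormLE y s) :
    NormLE (x * y) (r * s) := by
  obtain ⟨w, rfl, rfl⟩ := exists_frep₂ x y
  rw [fmul_eq]
  refine (fholds_fmap _ _ _).2 (((fholds_fmap _ _ _).1 hx).mono₂ ((fholds_fmap _ _ _).1 hy) ?_)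
  intro a h₁ h₂
  exact (norm_mul_le _ _).trans
    (mul_le_mul h₁ h₂ (norm_nonneg _) ((norm_nonneg _).trans h₁))

theorem normLE_star {x : M.Fiber B τ} {r : ℝ} (hx : NormLE x r) : NormLE (star x) r := by
  refine (fholds_fmap _ _ _).2 (Holds.mono hx fun a h => ?_)
  simpa using h

theorem normLE_smul {x : M.Fiber B τ} {r : ℝ} (c : ℂ) (hx : NormLE x r) :
    NormLE (c • x) (‖c‖ * r) := by
  refine (fholds_fmap _ _ _).2 (Holds.mono hx fun a h => ?_)
  exact (norm_smul c a.2).trans_le (mul_le_mul_of_nonneg_left h (norm_nonneg c))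

theorem isLimited_one : IsLimited (1 : M.Fiber B τ) := by
  refine ⟨1, ?_⟩
  rw [fone_eq (0 : M.Fiber B τ)]
  refine (fholds_fmap _ _ _).2 (holds_of_forall (fun p => ?_) _)
  rcases subsingleton_or_nontrivial (B p.1) with h | h
  · rw [Subsingleton.elim (1 : B p.1) 0, norm_zero]
    exact zero_le_one
  · exact (CStarRing.norm_one (E := B p.1)).le

variable (M B τ)

/-- `Fin(𝔅)`, the algebra over `ℂ` of the elements of limited norm. -/
noncomputable def Lim : StarSubalgebra ℂ (M.Fiber B τ) where
  carrier := {x | IsLimited x}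
  mul_mem' := fun ⟨_, h⟩ ⟨_, h'⟩ => ⟨_, normLE_mul h h'⟩
  add_mem' := fun ⟨_, h⟩ ⟨_, h'⟩ => ⟨_, normLE_add h h'⟩
  algebraMap_mem' := fun c => by
    rw [Algebra.algebraMap_eq_smul_one]
    obtain ⟨r, hr⟩ := isLimited_one (M := M) (B := B) (τ := τ)
    exact ⟨_, normLE_smul c hr⟩
  star_mem' := fun ⟨_, h⟩ => ⟨_, normLE_star h⟩

/-- The ideal of `Fin(𝔅)` of the elements of infinitesimal norm. -/
noncomputable def Infinitesimals : Ideal (M.Lim B τ) where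
  carrier := {x | IsInfinitesimal (x : M.Fiber B τ)}
  zero_mem' := fun _ hr => normLE_zero hr.le
  add_mem' := fun {a b} ha hb r hr => by
    have := normLE_add (ha (r / 2) (half_pos hr)) (hb (r / 2) (half_pos hr))
    rwa [add_halves] at this
  smul_mem' := fun c x hx r hr => by
    obtain ⟨s, hs⟩ := c.2
    have hs' : NormLE (c : M.Fiber B τ) (|s| + 1) :=
      Holds.mono hs fun a h => h.trans ((le_abs_self s).trans (by linarith))
    have hpos : 0 < |s| + 1 := by positivity
    have := normLE_mul hs' (hx (r / (|s| + 1)) (div_pos hr hpos))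
    rwa [mul_div_cancel₀ r hpos.ne'] at this

instance : (M.Infinitesimals B τ).IsTwoSided where
  mul_mem_of_left := fun {x} c hx r hr => by
    obtain ⟨s, hs⟩ := c.2
    have hs' : NormLE (c : M.Fiber B τ) (|s| + 1) :=
      Holds.mono hs fun a h => h.trans ((le_abs_self s).trans (by linarith))
    have hpos : 0 < |s| + 1 := by positivity
    have := normLE_mul (hx (r / (|s| + 1)) (div_pos hr hpos)) hs'
    rwa [div_mul_cancel₀ r hpos.ne'] at this

/-- The infinitesimal hull `Fin(𝔅) / {x | ‖x‖ ≅ 0}` of the internal C⋆-algebra `𝔅 = M.Fiber B τ`. -/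
abbrev Hull : Type u := M.Lim B τ ⧸ M.Infinitesimals B τ

variable {M B τ}

theorem star_mem_infinitesimals {x : M.Lim B τ} (hx : x ∈ M.Infinitesimals B τ) :
    star x ∈ M.Infinitesimals B τ := fun r hr => normLE_star (hx r hr)

/-- The involution of the hull, `π(x)⋆ = π(x⋆)`. -/
noncomputable instance : StarRing (M.Hull B τ) where
  star := Quotient.map' star fun x y h => by
    rw [Submodule.quotientRel_def] at h ⊢
    rw [← star_sub]
    exact star_mem_infinitesimals h
  star_involutive := by
    rintro ⟨x⟩
    exact congrArg (Ideal.Quotient.mk (M.Infinitesimals B τ)) (star_star x)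
  star_mul := by
    rintro ⟨x⟩ ⟨y⟩
    exact congrArg (Ideal.Quotient.mk (M.Infinitesimals B τ)) (star_mul x y)
  star_add := by
    rintro ⟨x⟩ ⟨y⟩
    exact congrArg (Ideal.Quotient.mk (M.Infinitesimals B τ)) (star_add x y)

end Hull

end NonstandardExtension

/-! ### Dimension vectors -/

/-- `min R`: the minimal nonzero central projections of `R`. -/
def MinCentralProj (R : Type v) [Ring R] [StarRing R] : Type v :=
  {e : R // (IsStarProjection e ∧ e ∈ Set.center R ∧ e ≠ 0) ∧
    ∀ f : R, IsStarProjection f → f ∈ Set.center R → f ≠ 0 → f * e = f → f = e}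

/-- `dim(e)`: the number `n` with `R e ≅ M_n(ℂ)`. A ⋆-isomorphism of `R e` with `M_n(ℂ)` is given as
a surjective ⋆-homomorphism `R → M_n(ℂ)` whose kernel is that of `x ↦ x e`. -/
noncomputable def dimProj {R : Type v} [Ring R] [StarRing R] [Algebra ℂ R] (e : MinCentralProj R) :
    ℕ :=
  sInf {n | ∃ ρ : R →⋆ₐ[ℂ] Matrix (Fin n) (Fin n) ℂ,
    Function.Surjective ρ ∧ ∀ x : R, ρ x = 0 ↔ x * e.1 = 0}

theorem MinCentralProj.mul_eq_zero {R : Type v} [Ring R] [StarRing R] {e f : MinCentralProj R}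
    (h : e ≠ f) : e.1 * f.1 = 0 := by
  by_contra hne
  obtain ⟨⟨he, hec, -⟩, hemin⟩ := e.2
  obtain ⟨⟨hf, hfc, -⟩, hfmin⟩ := f.2
  have hcomm : e.1 * f.1 = f.1 * e.1 := ((Set.mem_center_iff.1 hec).comm f.1).eq
  have hp : IsStarProjection (e.1 * f.1) := he.mul hf hcomm
  have hc : e.1 * f.1 ∈ Set.center R := Set.mul_mem_center hec hfc
  have h₁ : e.1 * f.1 = e.1 := hemin _ hp hc hne (by
    rw [mul_assoc, ← hcomm, ← mul_assoc, he.isIdempotentElem.eq])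
  have h₂ : e.1 * f.1 = f.1 := hfmin _ hp hc hne (by
    rw [mul_assoc, hf.isIdempotentElem.eq])
  exact h (Subtype.ext (h₁.symm.trans h₂))

instance MinCentralProj.finite {R : Type v} [Ring R] [StarRing R] [Algebra ℂ R]
    [FiniteDimensional ℂ R] : Finite (MinCentralProj R) := by
  have hli : LinearIndependent ℂ (fun e : MinCentralProj R => e.1) := by
    rw [linearIndependent_iff']
    intro s c hsum e he
    have h := congrArg (fun x => x * e.1) hsum
    simp only [Finset.sum_mul, zero_mul, smul_mul_assoc] at h
    rw [Finset.sum_eq_single e (fun f _ hf => by rw [mul_eq_zero hf, smul_zero])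
      (fun h' => absurd he h'), e.2.1.1.isIdempotentElem.eq] at h
    exact (smul_eq_zero.1 h).resolve_right e.2.1.2.2
  exact hli.finite

noncomputable instance MinCentralProj.fintype {R : Type v} [Ring R] [StarRing R] [Algebra ℂ R]
    [FiniteDimensional ℂ R] : Fintype (MinCentralProj R) := Fintype.ofFinite _

namespace NonstandardExtension

variable (M : NonstandardExtension.{u}) {T : Type} {τ : M.Ext T}

/-- An internal matrix `Γ` of hyperintegers with rows indexed by the internal set `M.Fiber J τ` and
columns by the (standard) finite set `I`, given by its columns `Γ e`, `e ∈ I`, is an inclusion matrix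
if it has no zero row and no zero column. -/
def IsInclusionMatrix {I : Type v} {J : T → Type} (Γ : I → M.Fiber (fun t => J t → ℕ) τ) : Prop :=
  (∀ f : M.Fiber J τ, ∃ e : I, eval (Γ e) f ≠ 0) ∧ ∀ e : I, ∃ f : M.Fiber J τ, eval (Γ e) f ≠ 0

/-- `m ∣ n`, for a standard finite dimension vector `m` and an internal dimension vector `n`:
there is an inclusion matrix `Γ` with `n = Γ m`. -/
def VecDvd {I : Type v} [Fintype I] {J : T → Type} (m : I → ℕ) (n : M.Fiber (fun t => J t → ℕ) τ) :
    Prop :=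
  ∃ Γ : I → M.Fiber (fun t => J t → ℕ) τ, M.IsInclusionMatrix Γ ∧
    ∀ f : M.Fiber J τ, eval n f = ∑ e, eval (Γ e) f * M.std (m e)

variable (B : T → Type) [∀ t, CStarAlgebra (B t)] (τ)

/-- The dimension vector of the hyperfinite dimensional C⋆-algebra `𝔅 = M.Fiber B τ`: the internal
family `f ↦ dim(f)` indexed by the internal set `min 𝔅`. -/
noncomputable def dimVec : M.Fiber (fun t => MinCentralProj (B t) → ℕ) τ :=
  fconst fun _ => dimProj

/-- `𝔅 = M.Fiber B τ` is internally ⋆-isomorphic to `M_N(•ℂ)`. -/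
def IsFullMatrixAlgebra (N : M.Ext ℕ) : Prop :=
  M.Holds (fun p : T × ℕ => Nonempty (B p.1 ≃⋆ₐ[ℂ] Matrix (Fin p.2) (Fin p.2) ℂ)) (M.pair τ N)

end NonstandardExtension

/-! Both directions pass through the statement that, at the level of the fibres `B t`, a matrix `Γ`
with `IsMultiplicity` exists; `vecDvd_dimVec_iff` identifies this, by transfer, with divisibility of
the internal dimension vectors.

From an embedding to divisibility (`holds_isMultiplicity_of_injective`): restrict the morphism to
one finite dimensional subalgebra and look at the images of its matrix units in the hull. The
diagonal ones are encoded in a single self-adjoint element, whose lift has its spectrum infinitely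
close to finitely many standard points; functional calculus then yields exact internal projections
(`exists_lift_projections`). The partial isometries are lifted arbitrarily, so their relations hold
only up to infinitesimals. That is enough, because an error of norm less than 1 cannot change a rank
(`rank_blockRep_le`): the ranks of the lifted projections in the blocks of `B t` are the required
multiplicities.

From divisibility to an embedding (`exists_injective_starAlgHom_hull`): multiplicities give a block
diagonal embedding of each subalgebra into `B t`. It is extended, discontinuously and non-linearly,
to all of `A` by composing with a nearly best approximation. The resulting conditions
`IsApproxEmbedding` become stronger as the subalgebra grows, so countable saturation provides one
internal map satisfying all of them. By density it respects the operations up to infinitesimals, and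
it induces an isometric morphism into the hull.

The block structure of finite dimensional C⋆-algebras is derived from the inner product `tr (x⋆ y)`
of the left regular representation. A full matrix algebra of positive size has one block, so there
divisibility of vectors is divisibility of numbers. -/

section FiniteDimensionalCStarAlgebra

/-! ### The regular trace form and representations on simple left ideals -/

open scoped ComplexOrder

/-- The endomorphisms of a finite dimensional complex inner product space are a full matrix algebra,
with adjoints corresponding to conjugate transposes. -/
theorem InnerProductSpace.Core.exists_matrix_algEquiv {V : Type v} [AddCommGroup V] [Module ℂ V]
    [FiniteDimensional ℂ V] (c : InnerProductSpace.Core ℂ V) :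
    ∃ e : Module.End ℂ V ≃ₐ[ℂ] Matrix (Fin (Module.finrank ℂ V)) (Fin (Module.finrank ℂ V)) ℂ,
      ∀ S T : Module.End ℂ V, (∀ x y, c.inner (S x) y = c.inner x (T y)) →
        e S = (e T).conjTranspose := by
  let _ := c.toNormedAddCommGroup
  let _ := InnerProductSpace.ofCore c.toCore
  let b := stdOrthonormalBasis ℂ V
  refine ⟨(LinearMap.toMatrixOrthonormal b).toAlgEquiv, fun S T h => ?_⟩
  have : S = star T := by
    rw [LinearMap.star_eq_adjoint, LinearMap.eq_adjoint_iff]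
    exact h
  subst this
  exact map_star (LinearMap.toMatrixOrthonormal b) T

theorem InnerProductSpace.Core.exists_orthogonal_decomposition {V : Type v} [AddCommGroup V]
    [Module ℂ V] [FiniteDimensional ℂ V] (c : InnerProductSpace.Core ℂ V) (K : Submodule ℂ V)
    (v : V) : ∃ p ∈ K, ∀ x ∈ K, c.inner x (v - p) = 0 := by
  let _ := c.toNormedAddCommGroup
  let _ := InnerProductSpace.ofCore c.toCore
  obtain ⟨p, hp, q, hq, rfl⟩ := K.exists_add_mem_mem_orthogonal v
  refine ⟨p, hp, fun x hx => ?_⟩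
  rw [add_sub_cancel_left]
  exact hq x hx

variable {R : Type v} [CStarAlgebra R]

theorem spectrum_mulLeft_subset (a : R) :
    spectrum ℂ (LinearMap.mulLeft ℂ a) ⊆ spectrum ℂ a := by
  have := AlgHom.spectrum_apply_subset (Algebra.lmul ℂ R) a
  exact this

/-- If left multiplication by `z - a` is bijective, the preimage of 1 is a right inverse of `z - a`,
and injectivity makes it a left inverse too. -/
theorem spectrum_subset_mulLeft (a : R) :
    spectrum ℂ a ⊆ spectrum ℂ (LinearMap.mulLeft ℂ a) := by
  intro z hz hz'
  apply hz
  rw [spectrum.mem_resolventSet_iff] at hz' ⊢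
  have e : algebraMap ℂ (Module.End ℂ R) z - LinearMap.mulLeft ℂ a =
      LinearMap.mulLeft ℂ (algebraMap ℂ R z - a) := by
    ext x
    simp [sub_mul, Algebra.smul_def]
  rw [e] at hz'
  obtain ⟨y, hy⟩ := ((Module.End.isUnit_iff _).1 hz').2 1
  rw [LinearMap.mulLeft_apply] at hy
  refine ⟨⟨_, y, hy, ((Module.End.isUnit_iff _).1 hz').1 ?_⟩, rfl⟩
  rw [LinearMap.mulLeft_apply, LinearMap.mulLeft_apply, ← mul_assoc, hy, one_mul, mul_one]

theorem complex_spectrum_star_mul_self_nonneg (a : R) : ∀ z ∈ spectrum ℂ (star a * a), 0 ≤ z := by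
  intro z hz
  have hsa := IsSelfAdjoint.star_mul_self a
  obtain ⟨x, hx, rfl⟩ : ∃ x ∈ spectrum ℝ (star a * a), (x : ℂ) = z := by
    have := hsa.spectrumRestricts.algebraMap_image
    rw [← this] at hz
    exact hz
  exact_mod_cast spectrum_star_mul_self_nonneg x hx

variable (R) in
/-- The linear functional `a ↦ tr (x ↦ a x)`. -/
noncomputable def regTrace : R →ₗ[ℂ] ℂ := LinearMap.trace ℂ R ∘ₗ LinearMap.mul ℂ R

variable [FiniteDimensional ℂ R]

/-- The trace is the sum of the roots of the characteristic polynomial, all of which lie in the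
spectrum of `a`. If a sum of nonnegative roots vanishes, so does every root, and a self-adjoint
element with spectrum in {0} is zero. -/
theorem trace_mulLeft_of_nonneg {a : R} (ha : IsSelfAdjoint a) (hs : ∀ z ∈ spectrum ℂ a, 0 ≤ z) :
    0 ≤ LinearMap.trace ℂ R (LinearMap.mulLeft ℂ a) ∧
      (LinearMap.trace ℂ R (LinearMap.mulLeft ℂ a) = 0 → a = 0) := by
  set L := LinearMap.mulLeft ℂ a
  have htr := Module.End.trace_eq_sum_roots_charpoly_of_splits
    (IsAlgClosed.splits L.charpoly)
  have hroot : ∀ z ∈ L.charpoly.roots, 0 ≤ z := fun z hz => by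
    apply hs z (spectrum_mulLeft_subset a _)
    rw [← Module.End.hasEigenvalue_iff_mem_spectrum, Module.End.hasEigenvalue_iff_isRoot_charpoly]
    exact Polynomial.isRoot_of_mem_roots hz
  rw [htr]
  refine ⟨Multiset.sum_nonneg hroot, fun h => ?_⟩
  apply CFC.eq_zero_of_spectrum_subset_zero (R := ℂ) a _ ha.isStarNormal
  intro z hz
  have hz' := spectrum_subset_mulLeft a hz
  rw [← Module.End.hasEigenvalue_iff_mem_spectrum,
    Module.End.hasEigenvalue_iff_isRoot_charpoly] at hz'
  have hm : z ∈ L.charpoly.roots :=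
    (Polynomial.mem_roots (LinearMap.charpoly_monic L).ne_zero).2 hz'
  refine le_antisymm ?_ (hroot z hm)
  rw [← h]
  exact Multiset.single_le_sum hroot z hm

theorem regTrace_star_mul_self_nonneg (a : R) : 0 ≤ regTrace R (star a * a) :=
  (trace_mulLeft_of_nonneg (.star_mul_self a) (complex_spectrum_star_mul_self_nonneg a)).1

theorem eq_zero_of_regTrace_star_mul_self {a : R} (h : regTrace R (star a * a) = 0) : a = 0 :=
  CStarRing.star_mul_self_eq_zero_iff a |>.1
    ((trace_mulLeft_of_nonneg (.star_mul_self a) (complex_spectrum_star_mul_self_nonneg a)).2 h)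

/-- For self-adjoint `b` the traces of `b⋆b`, of 1 and of `(b + 1)⋆(b + 1)` are real, hence so is
that of `b`. The general case follows by splitting into real and imaginary parts. -/
theorem regTrace_star (a : R) : regTrace R (star a) = star (regTrace R a) := by
  have hsa : ∀ b : R, IsSelfAdjoint b → star (regTrace R b) = regTrace R b := by
    intro b hb
    have hp := regTrace_star_mul_self_nonneg (b + 1)
    have hp' := regTrace_star_mul_self_nonneg b
    have h1 := regTrace_star_mul_self_nonneg (1 : R)
    have e : star (b + 1) * (b + 1) = star b * b + (2 : ℂ) • b + star 1 * 1 := by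
      rw [star_add, hb.star_eq, star_one, two_smul]
      noncomm_ring
    rw [e, map_add, map_add, map_smul] at hp
    rw [Complex.nonneg_iff] at hp hp' h1
    have hi : (regTrace R b).im = 0 := by
      have := hp.2
      simp only [Complex.add_im, smul_eq_mul, Complex.mul_im, Complex.re_ofNat,
        Complex.im_ofNat, zero_mul, add_zero] at this
      linarith [hp'.2, h1.2]
    exact Complex.conj_eq_iff_im.2 hi
  have h₁ := hsa _ (realPart a).2
  have h₂ := hsa _ (imaginaryPart a).2
  conv_lhs => rw [← realPart_add_I_smul_imaginaryPart a]
  conv_rhs => rw [← realPart_add_I_smul_imaginaryPart a]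
  rw [star_add, star_smul, map_add, map_add, map_smul, map_smul, star_add, star_smul,
    (realPart a).2.star_eq, (imaginaryPart a).2.star_eq, h₁, h₂]

/-- The inner product `⟨x, y⟩ = tr (x⋆ y)`, restricted to a left ideal. -/
@[reducible] noncomputable def regCore (V : Submodule R R) : InnerProductSpace.Core ℂ V where
  inner x y := regTrace R (star (x : R) * y)
  conj_inner_symm x y := by
    change star _ = _
    rw [← regTrace_star, star_mul, star_star]
  re_inner_nonneg x := (Complex.nonneg_iff.1 (regTrace_star_mul_self_nonneg (x : R))).1
  add_left x y z := by simp [add_mul]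
  smul_left x y r := by simp
  definite x h := Subtype.ext (eq_zero_of_regTrace_star_mul_self h)

/-- By Schur's lemma the `R`-endomorphisms of `V` are the scalars, so every ℂ-linear map commutes
with them. Jacobson density, applied to a finite spanning set, then realizes it by an element of
`R`. -/
theorem exists_smul_eq_of_isSimpleModule (V : Submodule R R)
    [IsSimpleModule R V] (f : V →ₗ[ℂ] V) : ∃ r : R, ∀ x : V, f x = r • x := by
  have hb := IsSimpleModule.algebraMap_end_bijective_of_isAlgClosed (A := R) (V := V) ℂ
  let f' : Module.End (Module.End R V) V :=
    { toFun := f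
      map_add' := f.map_add
      map_smul' := fun g x => by
        obtain ⟨c, rfl⟩ := hb.2 g
        simp }
  obtain ⟨s, hs⟩ := Module.Finite.fg_top (R := ℂ) (M := V)
  obtain ⟨r, hr⟩ := jacobson_density f' s
  refine ⟨r, fun x => ?_⟩
  have hx : x ∈ Submodule.span ℂ (s : Set V) := hs ▸ Submodule.mem_top
  induction hx using Submodule.span_induction with
  | mem x h => exact hr x h
  | zero => simp
  | add x y _ _ h₁ h₂ => rw [map_add, h₁, h₂, smul_add]
  | smul c x _ h => rw [map_smul, h, smul_comm]

/-- A simple left ideal gives a surjective ⋆-homomorphism to a matrix algebra. -/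
theorem exists_starAlgHom_of_isSimpleModule (V : Submodule R R) [IsSimpleModule R V] :
    ∃ (n : ℕ) (ρ : R →⋆ₐ[ℂ] Matrix (Fin n) (Fin n) ℂ), Function.Surjective ρ ∧
      ∀ x, ρ x = 0 ↔ ∀ y ∈ V, x * y = 0 := by
  obtain ⟨e, he⟩ := (regCore V).exists_matrix_algEquiv
  let l : R →ₐ[ℂ] Module.End ℂ V := Algebra.lsmul ℂ ℂ V
  have hl : ∀ a (x : V), ((l a x : V) : R) = a * x := fun a x => rfl
  refine ⟨_, { e.toAlgHom.comp l with map_star' := fun a => ?_ }, ?_, ?_⟩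
  -- For the trace form, the adjoint of left multiplication by `a` is left multiplication by `a⋆`.
  · refine he _ _ fun x y => ?_
    change regTrace R (star (star a * (x : R)) * y) = regTrace R (star (x : R) * (a * y))
    rw [star_mul, star_star, mul_assoc]
  · intro y
    obtain ⟨r, hr⟩ := exists_smul_eq_of_isSimpleModule V (e.symm y)
    refine ⟨r, ?_⟩
    change e (l r) = y
    rw [← e.eq_symm_apply]
    exact LinearMap.ext fun x => (hr x).symm
  · intro x
    change e (l x) = 0 ↔ _
    rw [map_eq_zero_iff e e.injective]
    constructor
    · intro h y hy
      have := hl x ⟨y, hy⟩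
      rw [h] at this
      exact this.symm
    · intro h
      ext y
      exact h y y.2

/-- A ⋆-closed two-sided ideal of a finite dimensional C⋆-algebra is generated by a central
projection. -/
theorem exists_central_projection_of_ker {S : Type*} [Ring S] [StarRing S] [Algebra ℂ S]
    (ρ : R →⋆ₐ[ℂ] S) :
    ∃ c : R, IsStarProjection c ∧ c ∈ Set.center R ∧ ∀ x, ρ x = 0 ↔ x * c = x := by
  let K : Submodule R R := RingHom.ker ρ
  have hK : ∀ x, x ∈ K ↔ ρ x = 0 := fun x => Iff.rfl
  -- The projection `c` is the orthogonal projection of 1 onto the kernel.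
  obtain ⟨c, hc, hc'⟩ : ∃ c ∈ K, ∀ x ∈ K, regTrace R (star x * (1 - c)) = 0 := by
    let K' : Submodule ℂ (⊤ : Submodule R R) := (K.restrictScalars ℂ).comap
      ((⊤ : Submodule R R).subtype.restrictScalars ℂ)
    obtain ⟨p, hp, h⟩ := (regCore (⊤ : Submodule R R)).exists_orthogonal_decomposition K'
      ⟨1, trivial⟩
    exact ⟨p, hp, fun x hx => h ⟨x, trivial⟩ hx⟩
  have hr : ∀ x ∈ K, x * c = x := by
    intro x hx
    have : x * (1 - c) = 0 := by
      apply eq_zero_of_regTrace_star_mul_self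
      -- Tested against this element of the kernel, orthogonality says that `x (1 - c)` has zero
      -- norm for the trace form.
      have := hc' (star x * (x * (1 - c))) (by
        rw [hK] at hx ⊢
        rw [map_mul, map_mul, hx, zero_mul, mul_zero])
      rwa [star_mul (star x), star_star, mul_assoc] at this
    rwa [mul_sub, mul_one, sub_eq_zero, eq_comm] at this
  have hstar : ∀ x ∈ K, star x ∈ K := fun x hx => by
    rw [hK] at hx ⊢
    rw [map_star, hx, star_zero]
  have hsa : star c = c := by
    have h := hr _ (hstar c hc)
    have h' := congrArg star h
    rw [star_mul, star_star] at h'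
    exact h.symm.trans h'
  have hl : ∀ x ∈ K, c * x = x := fun x hx => by
    have := congrArg star (hr _ (hstar x hx))
    rwa [star_mul, star_star, hsa] at this
  refine ⟨c, ⟨hr c hc, hsa⟩, ?_, fun x => ⟨fun hx => hr x hx, fun hx => ?_⟩⟩
  · rw [Semigroup.mem_center_iff]
    intro x
    have h₁ : x * c ∈ K := K.smul_mem x hc
    have h₂ : c * x ∈ K := by
      rw [hK] at hc ⊢
      rw [map_mul, hc, zero_mul]
    rw [← hl _ h₁, ← mul_assoc, hr _ h₂]
  · rw [← hx]
    exact K.smul_mem x hc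

end FiniteDimensionalCStarAlgebra

/-! ### Minimal central projections and the block decomposition -/

section DimensionVector

variable {R : Type v} [CStarAlgebra R]

theorem MinCentralProj.mul_comm (e : MinCentralProj R) (x : R) : e.1 * x = x * e.1 :=
  ((Set.mem_center_iff.1 e.2.1.2.1).comm x).eq

/-- Surjections with the same kernel have targets of the same dimension, so `n * n` is determined
and the infimum in `dimProj` runs over a single number. -/
theorem dimProj_eq {e : MinCentralProj R} {n : ℕ} (ρ : R →⋆ₐ[ℂ] Matrix (Fin n) (Fin n) ℂ)
    (hρ : Function.Surjective ρ) (hker : ∀ x : R, ρ x = 0 ↔ x * e.1 = 0) : dimProj e = n := by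
  have : {n | ∃ ρ : R →⋆ₐ[ℂ] Matrix (Fin n) (Fin n) ℂ,
      Function.Surjective ρ ∧ ∀ x : R, ρ x = 0 ↔ x * e.1 = 0} = {n} := by
    ext m
    refine ⟨?_, fun h => ?_⟩
    · rintro ⟨ρ', hρ', hker'⟩
      have hk : LinearMap.ker ρ.toAlgHom.toLinearMap = LinearMap.ker ρ'.toAlgHom.toLinearMap := by
        ext x
        exact (hker x).trans (hker' x).symm
      have e₁ := (ρ.toAlgHom.toLinearMap.quotKerEquivOfSurjective hρ).finrank_eq
      have e₂ := (ρ'.toAlgHom.toLinearMap.quotKerEquivOfSurjective hρ').finrank_eq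
      rw [hk, e₂] at e₁
      simp only [Module.finrank_matrix, Fintype.card_fin, Module.finrank_self, mul_one] at e₁
      exact Nat.mul_self_inj.1 e₁
    · rw [Set.mem_singleton_iff.1 h]
      exact ⟨ρ, hρ, hker⟩
  rw [dimProj, this, csInf_singleton]

theorem minCentralProj_eq_one_of_matrix {n : ℕ} (φ : R ≃⋆ₐ[ℂ] Matrix (Fin n) (Fin n) ℂ)
    (e : MinCentralProj R) : e.1 = 1 := by
  obtain ⟨⟨he, hec, he0⟩, -⟩ := e.2
  have hc : φ e.1 ∈ Set.center (Matrix (Fin n) (Fin n) ℂ) := by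
    rw [Semigroup.mem_center_iff]
    intro y
    obtain ⟨x, rfl⟩ := EquivLike.surjective φ y
    rw [← map_mul, ← map_mul, e.mul_comm]
  rw [Matrix.center_eq_scalar_image] at hc
  obtain ⟨c, -, hc⟩ := hc
  have hc' : φ e.1 = c • 1 := by rw [← hc, Matrix.scalar_apply, Matrix.smul_one_eq_diagonal]
  have hc0 : c ≠ 0 := fun h => he0 (EquivLike.injective φ (by rw [hc', h, zero_smul, map_zero]))
  apply EquivLike.injective φ
  have h := congrArg φ he.isIdempotentElem.eq
  rw [map_mul, hc', smul_mul_assoc, one_mul] at h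
  have h' := congrArg (c⁻¹ • ·) h
  simp only [smul_smul, inv_mul_cancel₀ hc0, one_smul, inv_mul_cancel_left₀ hc0] at h'
  rw [map_one, hc', h']

theorem dimProj_of_matrix {n : ℕ} (φ : R ≃⋆ₐ[ℂ] Matrix (Fin n) (Fin n) ℂ)
    (e : MinCentralProj R) : dimProj e = n := by
  refine dimProj_eq (φ : R →⋆ₐ[ℂ] Matrix (Fin n) (Fin n) ℂ) φ.surjective fun x => ?_
  rw [minCentralProj_eq_one_of_matrix φ e, mul_one]
  exact map_eq_zero_iff φ φ.injective

variable [FiniteDimensional ℂ R]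

theorem exists_minCentralProj_mul_eq {p : R} (hp : IsStarProjection p) (hc : p ∈ Set.center R)
    (h0 : p ≠ 0) : ∃ e : MinCentralProj R, e.1 * p = e.1 := by
  let S : Set R := {q | (IsStarProjection q ∧ q ∈ Set.center R ∧ q ≠ 0) ∧ q * p = q}
  -- Minimality is obtained from least dimension of `R q`: a smaller central projection `f` gives `R
  -- f ⊆ R q`, and equality of the two forces `f = q`.
  let d : R → ℕ := fun q => Module.finrank ℂ (LinearMap.range (LinearMap.mulRight ℂ q))
  have hS : S.Nonempty := ⟨p, ⟨hp, hc, h0⟩, hp.isIdempotentElem.eq⟩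
  obtain ⟨⟨hq, hqc, hq0⟩, hqp⟩ := Function.argminOn_mem d S hS
  set q := Function.argminOn d S hS
  refine ⟨⟨q, ⟨hq, hqc, hq0⟩, fun f hf hfc hf0 hfq => ?_⟩, hqp⟩
  have hle : d q ≤ d f :=
    Function.argminOn_le d S ⟨⟨hf, hfc, hf0⟩, by rw [← hfq, mul_assoc, hqp]⟩
  have hsub : LinearMap.range (LinearMap.mulRight ℂ f) ≤ LinearMap.range (LinearMap.mulRight ℂ q) := by
    rintro _ ⟨x, rfl⟩
    exact ⟨x * f, by simp [mul_assoc, hfq]⟩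
  have heq := Submodule.eq_of_le_of_finrank_le hsub hle
  obtain ⟨x, hx⟩ : q ∈ LinearMap.range (LinearMap.mulRight ℂ f) := heq ▸ ⟨1, by simp⟩
  rw [LinearMap.mulRight_apply] at hx
  rw [← hfq, ← ((Set.mem_center_iff.1 hqc).comm f).eq, ← hx, mul_assoc, hf.isIdempotentElem.eq]

/-- `R` acts on a simple left ideal `V` inside `R e`. The kernel of this action is generated by a
central projection `c`, and minimality leaves `c e = e` or `c e = 0`. In the first case `e`, which
is the identity on `V`, would annihilate `V`; hence the kernel is exactly the annihilator of `e`. -/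
theorem MinCentralProj.exists_starAlgHom (e : MinCentralProj R) :
    ∃ (n : ℕ) (ρ : R →⋆ₐ[ℂ] Matrix (Fin n) (Fin n) ℂ),
      Function.Surjective ρ ∧ ∀ x : R, ρ x = 0 ↔ x * e.1 = 0 := by
  obtain ⟨⟨he, hec, he0⟩, hmin⟩ := e.2
  have : IsArtinian R R := isArtinian_of_tower ℂ inferInstance
  obtain hbot | ⟨V, hV, hle⟩ := eq_bot_or_exists_atom_le (Submodule.span R {e.1})
  · exact absurd (Submodule.span_singleton_eq_bot.1 hbot) he0
  have := isSimpleModule_iff_isAtom.2 hV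
  obtain ⟨n, ρ, hρ, hker⟩ := exists_starAlgHom_of_isSimpleModule V
  have hVe : ∀ y ∈ V, e.1 * y = y := fun y hy => by
    obtain ⟨r, rfl⟩ := Submodule.mem_span_singleton.1 (hle hy)
    rw [smul_eq_mul, e.mul_comm, mul_assoc, he.isIdempotentElem.eq]
  refine ⟨n, ρ, hρ, fun x => ⟨fun hx => ?_, fun hx => (hker x).2 fun y hy => ?_⟩⟩
  · obtain ⟨c, hc, hcc, hcK⟩ := exists_central_projection_of_ker ρ
    have hce : c * e.1 = 0 := by
      by_contra hne
      have h₁ : c * e.1 = e.1 := hmin _ (hc.mul he (e.mul_comm c).symm) (Set.mul_mem_center hcc hec)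
        hne (by rw [mul_assoc, he.isIdempotentElem.eq])
      apply hV.1
      rw [eq_bot_iff]
      intro y hy
      have h₂ := (hker e.1).1 ((hcK _).2 (by rw [e.mul_comm, h₁])) y hy
      rw [hVe y hy] at h₂
      exact h₂
    rw [← (hcK x).1 hx, mul_assoc, hce, mul_zero]
  · rw [← hVe y hy, ← mul_assoc, hx, zero_mul]

theorem exists_blockRep (e : MinCentralProj R) :
    ∃ ρ : R →⋆ₐ[ℂ] Matrix (Fin (dimProj e)) (Fin (dimProj e)) ℂ,
      Function.Surjective ρ ∧ ∀ x : R, ρ x = 0 ↔ x * e.1 = 0 := by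
  obtain ⟨n, ρ, h⟩ := e.exists_starAlgHom
  rw [dimProj_eq ρ h.1 h.2]
  exact ⟨ρ, h⟩

/-- The irreducible representation of `R` on the block of `e`. -/
noncomputable def blockRep (e : MinCentralProj R) :
    R →⋆ₐ[ℂ] Matrix (Fin (dimProj e)) (Fin (dimProj e)) ℂ := (exists_blockRep e).choose

theorem blockRep_surjective (e : MinCentralProj R) : Function.Surjective (blockRep e) :=
  (exists_blockRep e).choose_spec.1

theorem blockRep_eq_zero_iff {e : MinCentralProj R} {x : R} : blockRep e x = 0 ↔ x * e.1 = 0 :=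
  (exists_blockRep e).choose_spec.2 x

theorem dimProj_pos (e : MinCentralProj R) : 0 < dimProj e := by
  by_contra h
  have h0 : dimProj e = 0 := by omega
  have : IsEmpty (Fin (dimProj e)) := by rw [h0]; infer_instance
  have h₁ : blockRep e 1 = 0 := Subsingleton.elim _ _
  rw [blockRep_eq_zero_iff, one_mul] at h₁
  exact e.2.1.2.2 h₁

/-- Otherwise the complement of the sum is a nonzero central projection and dominates a minimal one,
which is already a summand. -/
theorem sum_minCentralProj : ∑ e : MinCentralProj R, e.1 = 1 := by
  classical
  set s := ∑ e : MinCentralProj R, e.1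
  have hs : ∀ e : MinCentralProj R, e.1 * s = e.1 := fun e => by
    rw [Finset.mul_sum, Finset.sum_eq_single e, e.2.1.1.isIdempotentElem.eq]
    · exact fun f _ hf => MinCentralProj.mul_eq_zero hf.symm
    · simp
  have hss : s * s = s := by
    conv_lhs => rw [Finset.sum_mul]
    exact Finset.sum_congr rfl fun e _ => hs e
  have hsp : IsStarProjection s :=
    ⟨hss, by rw [isSelfAdjoint_iff, star_sum]; exact Finset.sum_congr rfl fun e _ => e.2.1.1.2⟩
  have hsc : s ∈ Set.center R := by
    rw [Semigroup.mem_center_iff]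
    intro x
    rw [Finset.mul_sum, Finset.sum_mul]
    exact Finset.sum_congr rfl fun e _ => (e.mul_comm x).symm
  by_contra hne
  obtain ⟨e, he⟩ := exists_minCentralProj_mul_eq hsp.one_sub
    (Semigroup.mem_center_iff.2 fun x => by
      rw [mul_sub, sub_mul, Semigroup.mem_center_iff.1 hsc x, one_mul, mul_one])
    (sub_ne_zero.2 (Ne.symm hne))
  rw [mul_sub, mul_one, hs, sub_self] at he
  exact e.2.1.2.2 he.symm

/-- A finite dimensional C⋆-algebra is the direct sum of its blocks. -/
theorem exists_starAlgEquiv_pi :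
    ∃ Φ : R ≃⋆ₐ[ℂ] (∀ e : MinCentralProj R, Matrix (Fin (dimProj e)) (Fin (dimProj e)) ℂ),
      ∀ x e, Φ x e = blockRep e x := by
  classical
  let Φ : R →⋆ₐ[ℂ] (∀ e : MinCentralProj R, Matrix (Fin (dimProj e)) (Fin (dimProj e)) ℂ) :=
    { toFun := fun x e => blockRep e x
      map_one' := by ext1 e; simp
      map_zero' := by ext1 e; simp
      map_mul' := fun x y => by ext1 e; simp
      map_add' := fun x y => by ext1 e; simp
      map_star' := fun x => by ext1 e; exact map_star (blockRep e) x
      commutes' := fun c => by ext1 e; exact AlgHomClass.commutes (blockRep e) c }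
  have hinj : Function.Injective Φ := by
    rw [injective_iff_map_eq_zero]
    intro x hx
    rw [← mul_one x, ← sum_minCentralProj, Finset.mul_sum]
    exact Finset.sum_eq_zero fun e _ => blockRep_eq_zero_iff.1 (congrFun hx e)
  have hsurj : Function.Surjective Φ := by
    intro y
    choose g hg using fun e => blockRep_surjective (R := R) e
    refine ⟨∑ e, g e (y e) * e.1, ?_⟩
    ext1 f
    change blockRep f _ = _
    have h1 : blockRep f f.1 = 1 := by
      rw [← sub_eq_zero, ← map_one (blockRep f), ← map_sub, blockRep_eq_zero_iff, sub_mul,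
        f.2.1.1.isIdempotentElem.eq, one_mul, sub_self]
    rw [map_sum, Finset.sum_eq_single f, map_mul, hg, h1, mul_one]
    · intro e _ he
      rw [map_mul, blockRep_eq_zero_iff.2 (MinCentralProj.mul_eq_zero he), mul_zero]
    · simp
  exact ⟨StarAlgEquiv.ofBijective Φ ⟨hinj, hsurj⟩, fun x e => rfl⟩

theorem nonempty_minCentralProj_of_matrix {n : ℕ} (hn : n ≠ 0)
    (φ : R ≃⋆ₐ[ℂ] Matrix (Fin n) (Fin n) ℂ) : Nonempty (MinCentralProj R) := by
  have : Nonempty (Fin n) := ⟨⟨0, by omega⟩⟩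
  have : Nontrivial R := φ.toEquiv.nontrivial
  obtain ⟨e, -⟩ := exists_minCentralProj_mul_eq (R := R) (p := 1) (.one R) (Set.one_mem_center)
    one_ne_zero
  exact ⟨e⟩

end DimensionVector

/-! ### Ranks of idempotent matrices -/

section Rank

variable {n : Type*} [Fintype n]

theorem Matrix.rank_add_le_rank_add_rank (A B : Matrix n n ℂ) :
    (A + B).rank ≤ A.rank + B.rank := by
  have h : LinearMap.range (A + B).mulVecLin ≤
      LinearMap.range A.mulVecLin ⊔ LinearMap.range B.mulVecLin := by
    rintro _ ⟨x, rfl⟩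
    rw [Matrix.mulVecLin_add]
    exact Submodule.add_mem_sup ⟨x, rfl⟩ ⟨x, rfl⟩
  exact (Submodule.finrank_mono h).trans (Submodule.finrank_add_le_finrank_add_finrank _ _)

variable [DecidableEq n]

theorem Matrix.trace_eq_rank_of_isIdempotentElem {P : Matrix n n ℂ} (hP : IsIdempotentElem P) :
    P.trace = P.rank := by
  have h : IsIdempotentElem (Matrix.toLin' P) := by
    rw [IsIdempotentElem, Module.End.mul_eq_comp, ← Matrix.toLin'_mul, hP.eq]
  have := ((LinearMap.isProj_range_iff_isIdempotentElem _).2 h).trace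
  rwa [Matrix.trace_toLin'_eq] at this

/-- Trace is additive and equals rank on idempotents, so no orthogonality between the summands has
to be assumed. -/
theorem Matrix.sum_rank_eq_card {κ : Type*} (s : Finset κ) {P : κ → Matrix n n ℂ}
    (hP : ∀ k ∈ s, IsIdempotentElem (P k)) (hsum : ∑ k ∈ s, P k = 1) :
    ∑ k ∈ s, (P k).rank = Fintype.card n := by
  have h := congrArg Matrix.trace hsum
  rw [Matrix.trace_sum, Matrix.trace_one,
    Finset.sum_congr rfl fun k hk => Matrix.trace_eq_rank_of_isIdempotentElem (hP k hk)] at h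
  exact_mod_cast h

end Rank

/-! ### Multiplicities: stability of ranks and block diagonal embeddings -/

section Inclusion

/-- The matrix `Γ` is an inclusion matrix from `m` to the dimension vector of `B`. -/
def IsMultiplicity {I : Type*} [Fintype I] (m : I → ℕ) {B : Type v} [Ring B] [StarRing B]
    [Algebra ℂ B] (Γ : I → MinCentralProj B → ℕ) : Prop :=
  (∀ f, dimProj f = ∑ e, Γ e f * m e) ∧ ∀ e, ∃ f, Γ e f ≠ 0

variable {B : Type v} [CStarAlgebra B] [FiniteDimensional ℂ B]

/-- The element `1 - (P - a Q b)` is invertible by the Neumann series. Its image in a block of size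
`d` has rank `d`, which is at most `rank (1 - P) + rank (a Q b)`, that is, at most `d - rank P +
rank Q`. -/
theorem rank_blockRep_le {P Q a b : B} (hP : IsIdempotentElem P) (h : ‖P - a * Q * b‖ < 1)
    (f : MinCentralProj B) : (blockRep f P).rank ≤ (blockRep f Q).rank := by
  have hu : IsUnit (blockRep f (1 - P + a * Q * b)) := by
    have := isUnit_one_sub_of_norm_lt_one h
    rw [← sub_add] at this
    exact this.map (blockRep f)
  have h₁ := Matrix.rank_of_isUnit _ hu
  rw [map_add] at h₁
  have h₂ := Matrix.rank_add_le_rank_add_rank (blockRep f (1 - P)) (blockRep f (a * Q * b))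
  have h₃ : (blockRep f (a * Q * b)).rank ≤ (blockRep f Q).rank := by
    rw [map_mul, map_mul]
    exact (Matrix.rank_mul_le_left _ _).trans (Matrix.rank_mul_le_right _ _)
  have h₄ := Matrix.sum_rank_eq_card (Finset.univ : Finset (Fin 2))
    (P := fun k => blockRep f (if k = 0 then P else 1 - P)) (fun k _ => by
      fin_cases k
      · exact hP.map (blockRep f)
      · exact hP.one_sub.map (blockRep f)) (by simp)
  simp only [Fin.sum_univ_two, if_true, Fin.one_eq_zero_iff, if_neg (show ¬ (2 = 1) by decide)] at h₄
  simp at h₄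
  simp only [Fintype.card_fin] at h₁
  simp only [map_sub, map_one] at h₂ h₁
  omega

theorem exists_blockRep_ne_zero {x : B} (hx : x ≠ 0) : ∃ f, blockRep f x ≠ 0 := by
  obtain ⟨Φ, hΦ⟩ := exists_starAlgEquiv_pi (R := B)
  by_contra! h
  apply hx
  apply EquivLike.injective Φ
  ext1 f
  rw [map_zero, hΦ, h]
  rfl

/-- An approximate system of diagonal matrix units, consisting of exact projections, determines an
inclusion matrix. -/
theorem exists_isMultiplicity_of_projections {I : Type*} [Fintype I] {m : I → ℕ} (hm : ∀ e, 0 < m e)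
    (P v : (Σ e, Fin (m e)) → B) (hP : ∀ k, IsIdempotentElem (P k)) (hsum : ∑ k, P k = 1)
    (h₁ : ∀ k, ‖P k - star (v k) * P ⟨k.1, 0, hm k.1⟩ * v k‖ < 1)
    (h₂ : ∀ k, ‖P ⟨k.1, 0, hm k.1⟩ - v k * P k * star (v k)‖ < 1)
    (h0 : ∀ e, P ⟨e, 0, hm e⟩ ≠ 0) : ∃ Γ : I → MinCentralProj B → ℕ, IsMultiplicity m Γ := by
  refine ⟨fun e f => (blockRep f (P ⟨e, 0, hm e⟩)).rank, fun f => ?_, fun e => ?_⟩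
  · have hs := Matrix.sum_rank_eq_card Finset.univ (P := fun k => blockRep f (P k))
      (fun k _ => (hP k).map (blockRep f)) (by rw [← map_sum, hsum, map_one])
    rw [Fintype.card_fin, Fintype.sum_sigma] at hs
    rw [← hs]
    refine Finset.sum_congr rfl fun e _ => ?_
    -- The two approximate relations bound the ranks in both directions, so all diagonal projections
    -- of a block `e` have equal rank in block `f`.
    rw [Finset.sum_congr rfl fun j _ => le_antisymm
      (rank_blockRep_le (hP ⟨e, j⟩) (h₁ ⟨e, j⟩) f)
      (rank_blockRep_le (hP ⟨e, 0, hm e⟩) (h₂ ⟨e, j⟩) f)]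
    change ∑ _j, (blockRep f (P ⟨e, 0, hm e⟩)).rank = _
    rw [Finset.sum_const, Finset.card_univ, Fintype.card_fin, smul_eq_mul, mul_comm]
  · obtain ⟨f, hf⟩ := exists_blockRep_ne_zero (h0 e)
    refine ⟨f, fun h => hf ?_⟩
    have h' := LinearMap.range_eq_bot.1 (Submodule.finrank_eq_zero.1 h)
    exact Matrix.toLin'.injective ((Matrix.toLin'_apply' _).trans (h'.trans (map_zero _).symm))

/-- The block diagonal embedding with multiplicities `g`. -/
theorem exists_blockDiagonal_starAlgHom {I : Type*} [Fintype I] (m g : I → ℕ) {d : ℕ}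
    (hd : d = ∑ e, g e * m e) :
    ∃ θ : (∀ e, Matrix (Fin (m e)) (Fin (m e)) ℂ) →⋆ₐ[ℂ] Matrix (Fin d) (Fin d) ℂ,
      ∀ y, θ y = 0 → ∀ e, g e ≠ 0 → y e = 0 := by
  classical
  have hcard : Nonempty ((Σ p : (Σ e, Fin (g e)), Fin (m p.1)) ≃ Fin d) := by
    rw [← Fintype.card_eq]
    simp only [Fintype.card_sigma, Fintype.card_fin, Fintype.sum_sigma, Finset.sum_const,
      Finset.card_univ, smul_eq_mul]
    exact hd.symm
  obtain ⟨r⟩ := hcard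
  let D : (∀ e, Matrix (Fin (m e)) (Fin (m e)) ℂ) → Matrix _ _ ℂ := fun y =>
    Matrix.blockDiagonal' fun p : (Σ e, Fin (g e)) => y p.1
  let ψ := Matrix.reindexAlgEquiv ℂ ℂ r
  have hone : D 1 = 1 := Matrix.blockDiagonal'_one
  have hzero : D 0 = 0 := Matrix.blockDiagonal'_zero
  refine ⟨{ toFun := fun y => ψ (D y)
            map_one' := (congrArg ψ hone).trans (map_one ψ)
            map_zero' := (congrArg ψ hzero).trans (map_zero ψ)
            map_mul' := fun x y => ?_
            map_add' := fun x y => ?_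
            commutes' := fun c => ?_
            map_star' := fun x => ?_ }, fun y hy e he => ?_⟩
  · rw [← map_mul]
    exact congrArg ψ (Matrix.blockDiagonal'_mul _ _)
  · rw [← map_add]
    exact congrArg ψ (Matrix.blockDiagonal'_add _ _)
  · have : ψ (D (algebraMap ℂ _ c)) = ψ (algebraMap ℂ _ c) := by
      rw [Algebra.algebraMap_eq_smul_one, Algebra.algebraMap_eq_smul_one, ← hone]
      exact congrArg ψ (Matrix.blockDiagonal'_smul c _)
    rw [this, AlgEquiv.commutes]
  · change Matrix.reindex r r _ = (Matrix.reindex r r _).conjTranspose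
    rw [Matrix.conjTranspose_reindex]
    exact congrArg (Matrix.reindex r r) (Matrix.blockDiagonal'_conjTranspose _).symm
  · have h : D y = 0 := (map_eq_zero_iff ψ ψ.injective).1 hy
    rw [← hzero] at h
    exact congrFun (Matrix.blockDiagonal'_injective h) ⟨e, 0, Nat.pos_of_ne_zero he⟩

/-- An inclusion matrix between dimension vectors is realized by an injective ⋆-homomorphism. -/
theorem exists_starAlgHom_of_isMultiplicity {F : Type*} [CStarAlgebra F] [FiniteDimensional ℂ F]
    {Γ : MinCentralProj F → MinCentralProj B → ℕ}
    (hΓ : IsMultiplicity (dimProj (R := F)) Γ) :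
    ∃ ρ : F →⋆ₐ[ℂ] B, Function.Injective ρ := by
  classical
  obtain ⟨Φ, hΦ⟩ := exists_starAlgEquiv_pi (R := F)
  obtain ⟨Ψ, -⟩ := exists_starAlgEquiv_pi (R := B)
  choose θ hθ using fun f => exists_blockDiagonal_starAlgHom (dimProj (R := F)) (Γ · f) (hΓ.1 f)
  refine ⟨(Ψ.symm : _ →⋆ₐ[ℂ] B).comp
    { toFun := fun x f => θ f (Φ x)
      map_one' := by ext1 f; rw [map_one, map_one, Pi.one_apply]
      map_zero' := by ext1 f; rw [map_zero, map_zero, Pi.zero_apply]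
      map_mul' := fun x y => by ext1 f; rw [map_mul, map_mul, Pi.mul_apply]
      map_add' := fun x y => by ext1 f; rw [map_add, map_add, Pi.add_apply]
      map_star' := fun x => by ext1 f; rw [map_star, map_star, Pi.star_apply]
      commutes' := fun c => by
        ext1 f
        rw [AlgHomClass.commutes, AlgHomClass.commutes, Pi.algebraMap_apply] }, ?_⟩
  refine (EquivLike.injective Ψ.symm).comp ?_
  intro x y hxy
  apply EquivLike.injective Φ
  ext1 e
  -- Injectivity is the absence of a zero column: each block `e` occurs in some block `f`.
  obtain ⟨f, hf⟩ := hΓ.2 e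
  have h : θ f (Φ x) = θ f (Φ y) := congrFun hxy f
  rw [← sub_eq_zero, ← map_sub] at h
  exact sub_eq_zero.1 (hθ f _ h e hf)

end Inclusion

/-! ### Transfer of quantifiers over internal fibres -/

namespace NonstandardExtension

section TransferFiber

variable {M : NonstandardExtension.{u}} {X Y : Type} {T : Type} {τ : M.Ext T} {C D J : T → Type}

theorem holds_forall_finset {ι : Type*} (s : Finset ι) (P : ι → X → Prop) (x : M.Ext X) :
    M.Holds (fun a => ∀ k ∈ s, P k a) x ↔ ∀ k ∈ s, M.Holds (P k) x := by
  classical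
  induction s using Finset.induction_on with
  | empty => simpa using holds_of_forall (fun _ => trivial) x
  | insert k s _ ih =>
    simp only [Finset.forall_mem_insert]
    rw [holds_and, ih]

theorem holds_forall_finite {ι : Type*} [Finite ι] (P : ι → X → Prop) (x : M.Ext X) :
    M.Holds (fun a => ∀ k, P k a) x ↔ ∀ k, M.Holds (P k) x := by
  have := Fintype.ofFinite ι
  simpa using holds_forall_finset Finset.univ P x

theorem map_eq_zero_iff_holds (g : X → ℕ) (x : M.Ext X) :
    M.map g x = 0 ↔ M.Holds (fun a => g a = 0) x := by
  rw [holds_eq g (fun _ => 0), map_const]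
  rfl

theorem map_ne_zero_iff_holds (g : X → ℕ) (x : M.Ext X) :
    M.map g x ≠ 0 ↔ M.Holds (fun a => g a ≠ 0) x := by
  rw [holds_not, Ne, map_eq_zero_iff_holds]

theorem map_mul_std (g : X → ℕ) (n : ℕ) (x : M.Ext X) :
    M.map g x * M.std n = M.map (fun a => g a * n) x := by
  rw [← map_const n x]
  exact map₂_map _ _ _ _

theorem sum_map {ι : Type*} (s : Finset ι) (g : ι → X → ℕ) (x : M.Ext X) :
    ∑ k ∈ s, M.map (g k) x = M.map (fun a => ∑ k ∈ s, g k a) x := by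
  classical
  induction s using Finset.induction_on with
  | empty => exact (map_const 0 x).symm
  | insert k s hk ih =>
    rw [Finset.sum_insert hk, ih]
    simp only [Finset.sum_insert hk]
    exact map₂_map _ _ _ _

theorem eval_fmap (g : ∀ t, C t → J t → Y) (h : ∀ t, C t → J t) (w : M.Fiber C τ) :
    eval (fmap g w) (fmap h w) = M.map (fun p => g p.1 p.2 (h p.1 p.2)) w.1 := by
  rw [eval, fpair_fmap]
  exact M.map_comp _ _ _

/-- A finite family of internal points is internal. -/
theorem exists_ftuple {n : ℕ} (x : Fin n → M.Fiber C τ) :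
    ∃ w : M.Fiber (fun t => Fin n → C t) τ, ∀ k, fmap (fun _ a => a k) w = x k := by
  induction n with
  | zero => exact ⟨fconst fun _ => Fin.elim0, fun k => k.elim0⟩
  | succ n ih =>
    obtain ⟨w', hw'⟩ := ih fun k => x k.succ
    obtain ⟨z, h₁, h₂⟩ := exists_fpair (x 0) w'
    refine ⟨fmap (fun t a => (Fin.cons a.1 a.2 : Fin (n + 1) → C t)) z, fun k => ?_⟩
    rw [fmap_fmap]
    refine Fin.cases ?_ (fun k => ?_) k
    · exact h₁
    · rw [← hw' k, ← h₂, fmap_fmap]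
      rfl

theorem FHolds.exists_point {R : ∀ t, C t → D t → Prop} {w : M.Fiber C τ}
    (h : FHolds (fun t a => ∃ b, R t a b) w) :
    ∃ z : M.Fiber (fun t => C t × D t) τ,
      fmap (fun _ p => p.1) z = w ∧ FHolds (fun t p => R t p.1 p.2) z := by
  obtain ⟨q, hq⟩ := exists_subtype h
  refine ⟨⟨M.map (fun q => ⟨q.1.1, q.1.2, q.2.choose⟩) q, ?_⟩, Subtype.ext ?_, ?_⟩
  · rw [M.map_comp, ← M.map_comp Sigma.fst Subtype.val, hq, w.2]
  · exact (M.map_comp _ _ _).trans hq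
  · exact (holds_map _ _ _).2 (holds_of_forall (fun q => q.2.choose_spec) q)

/-- The backward implication is by contraposition: a failure of the universal statement yields an
internal counterexample through `FHolds.exists_point`. -/
theorem fholds_forall_iff {R : ∀ t, C t → D t → Prop} {w : M.Fiber C τ} :
    FHolds (fun t a => ∀ b, R t a b) w ↔
      ∀ z : M.Fiber (fun t => C t × D t) τ, fmap (fun _ p => p.1) z = w →
        FHolds (fun t p => R t p.1 p.2) z := by
  constructor
  · rintro h z rfl
    exact ((fholds_fmap _ _ _).1 h).mono fun p hp => hp p.2.2
  · intro h
    by_contra hn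
    have hn' : FHolds (fun t a => ∃ b, ¬ R t a b) w :=
      ((holds_not _ _).2 hn).mono fun p hp => not_forall.1 hp
    obtain ⟨z, hz, hz'⟩ := hn'.exists_point
    exact (holds_not _ _).1 hz' (h z hz)

theorem FHolds.holds_exists {P : ∀ t, C t → Prop} {w : M.Fiber C τ} (h : FHolds P w) :
    M.Holds (fun t => ∃ a, P t a) τ := by
  rw [← w.2, holds_map]
  exact h.mono fun p hp => ⟨p.2, hp⟩

theorem exists_fholds_of_holds {P : ∀ t, C t → Prop} (h : M.Holds (fun t => ∃ a, P t a) τ) :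
    ∃ w : M.Fiber C τ, FHolds P w := by
  have h' : FHolds (fun t (_ : Unit) => ∃ a, P t a) (fconst fun _ => () : M.Fiber (fun _ => Unit) τ) :=
    (holds_map _ _ _).2 h
  obtain ⟨z, -, hz⟩ := h'.exists_point
  exact ⟨fmap (fun _ p => p.2) z, (fholds_fmap _ _ _).2 hz⟩

end TransferFiber

/-! ### Transfer of divisibility -/

section VecDvd

variable {M : NonstandardExtension.{u}} {T : Type} {τ : M.Ext T} {B : T → Type}
  [∀ t, CStarAlgebra (B t)] [∀ t, FiniteDimensional ℂ (B t)]

/-- Transfer of divisibility of dimension vectors. -/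
theorem vecDvd_dimVec_iff {I : Type v} [Fintype I] (m : I → ℕ) :
    M.VecDvd m (M.dimVec τ B) ↔
      M.Holds (fun t => ∃ Γ : I → MinCentralProj (B t) → ℕ, IsMultiplicity m Γ) τ := by
  -- Indexing the columns by `Fin` packs them into one internal point and avoids the universe of
  -- `I`.
  let ε := Fintype.equivFin I
  constructor
  · rintro ⟨Γ, ⟨-, hcol⟩, hΓ⟩
    obtain ⟨w, hw⟩ := exists_ftuple fun k => Γ (ε.symm k)
    have hw' : ∀ e, Γ e = fmap (fun _ a => a (ε e)) w := fun e => by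
      rw [hw, ε.symm_apply_apply]
    have key : FHolds (fun t a => IsMultiplicity (B := B t) m fun e => a (ε e)) w := by
      refine (holds_and _ _ _).2 ⟨?_, ?_⟩
      · refine fholds_forall_iff (R := fun t (a : Fin _ → MinCentralProj (B t) → ℕ)
          (f : MinCentralProj (B t)) => dimProj f = ∑ e, a (ε e) f * m e).2 ?_
        rintro z rfl
        have h := hΓ (fmap (fun _ p => p.2) z)
        rw [dimVec, fconst_eq _ z] at h
        simp only [hw', fmap_fmap, eval_fmap, map_mul_std, sum_map] at h
        exact (holds_eq _ _ _).2 h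
      · refine (holds_forall_finite _ _).2 fun e => ?_
        obtain ⟨f, hf⟩ := hcol e
        obtain ⟨z, hz, rfl⟩ := exists_frep₂ w f
        rw [hw', hz, fmap_fmap, eval_fmap, map_ne_zero_iff_holds] at hf
        rw [hz]
        exact (holds_map _ _ _).2 (hf.mono fun p hp => ⟨p.2.2, hp⟩)
    exact key.holds_exists.mono fun t ht => ht.elim fun a ha => ⟨_, ha⟩
  · intro h
    have h' : M.Holds (fun t => ∃ a : Fin _ → MinCentralProj (B t) → ℕ,
        IsMultiplicity m fun e => a (ε e)) τ :=
      h.mono fun t ⟨Γ, hΓ⟩ => ⟨fun k => Γ (ε.symm k), by simpa using hΓ⟩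
    obtain ⟨w, hw⟩ := exists_fholds_of_holds h'
    have hval : ∀ f : M.Fiber (fun t => MinCentralProj (B t)) τ,
        ∃ z : M.Fiber (fun t => (Fin _ → MinCentralProj (B t) → ℕ) × MinCentralProj (B t)) τ,
          w = fmap (fun _ p => p.1) z ∧ f = fmap (fun _ p => p.2) z ∧
          FHolds (fun t p => dimProj p.2 = ∑ e, p.1 (ε e) p.2 * m e) z := by
      intro f
      obtain ⟨z, hz, rfl⟩ := exists_frep₂ w f
      refine ⟨z, hz, rfl, ?_⟩
      exact fholds_forall_iff (R := fun t (a : Fin _ → MinCentralProj (B t) → ℕ)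
        (f : MinCentralProj (B t)) => dimProj f = ∑ e, a (ε e) f * m e).1 ((holds_and _ _ _).1 hw).1 z hz.symm
    refine ⟨fun e => fmap (fun _ a => a (ε e)) w, ⟨fun f => ?_, fun e => ?_⟩, fun f => ?_⟩
    · obtain ⟨z, rfl, rfl, hz⟩ := hval f
      -- `IsMultiplicity` does not mention zero rows: such a row would give a block of dimension 0,
      -- contrary to `dimProj_pos`.
      by_contra! hn
      simp only [fmap_fmap, eval_fmap, map_eq_zero_iff_holds] at hn
      obtain ⟨p, hp⟩ := (hz.mono₂ ((holds_forall_finite _ _).2 hn) (R := fun _ => False)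
        fun p h₁ h₂ => (dimProj_pos p.2.2).ne' (h₁.trans
          (Finset.sum_eq_zero fun e _ => by rw [h₂ e, zero_mul]))).exists_of
      exact hp
    · have hc : FHolds (fun t (a : Fin _ → MinCentralProj (B t) → ℕ) =>
          ∃ f : MinCentralProj (B t), a (ε e) f ≠ 0) w := (holds_forall_finite _ _).1 ((holds_and _ _ _).1 hw).2 e
      obtain ⟨z, rfl, hz⟩ := hc.exists_point
      refine ⟨fmap (fun _ p => p.2) z, ?_⟩
      dsimp only
      rw [fmap_fmap, eval_fmap, map_ne_zero_iff_holds]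
      exact hz
    · obtain ⟨z, rfl, rfl, hz⟩ := hval f
      rw [dimVec, fconst_eq _ z]
      simp only [fmap_fmap, eval_fmap, map_mul_std, sum_map]
      exact (holds_eq _ _ _).1 hz

end VecDvd

end NonstandardExtension

/-! ### Countable saturation -/

namespace NonstandardExtension

section Saturation

variable {M : NonstandardExtension.{u}} {X T : Type} {τ : M.Ext T} {C : T → Type}

theorem holds_le_of_unlimited {N : M.Ext ℕ} (hN : ∀ n : ℕ, N ≠ M.std n) (i : ℕ) :
    M.Holds (fun n => i ≤ n) N := by
  have h : M.Holds (fun n => ∀ k ∈ Finset.range i, ¬ n = k) N := by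
    refine (holds_forall_finset _ _ _).2 fun k _ => (holds_not _ _).2 fun h => hN k ?_
    have := (holds_eq (fun n => n) (fun _ => k) N).1 h
    rwa [M.map_id, map_const] at this
  refine h.mono fun n hn => ?_
  by_contra! hlt
  exact hn n (Finset.mem_range.2 hlt) rfl

/-- Countable saturation for decreasing sequences of internal sets. -/
theorem exists_holds_of_antitone (f : X → T) (P : ℕ → X → Prop)
    (hP : ∀ i j, i ≤ j → ∀ a, P j a → P i a)
    (h : ∀ n, ∃ x : M.Ext X, M.map f x = τ ∧ M.Holds (P n) x) :
    ∃ x : M.Ext X, M.map f x = τ ∧ ∀ n, M.Holds (P n) x := by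
  classical
  choose s hs using h
  obtain ⟨g, hg⟩ := M.saturation s
  obtain ⟨N, hN⟩ := M.exists_unlimited
  let Q : (ℕ → X) × T × ℕ → ℕ → Prop := fun p j => P j (p.1 j) ∧ f (p.1 j) = p.2.1
  -- The internal sequence is good at every standard index. The largest good index up to the
  -- unlimited `N` therefore exceeds every standard `n`, and the point found there satisfies all `P
  -- n` since these are decreasing.
  let k : (ℕ → X) × T × ℕ → ℕ := fun p => Nat.findGreatest (Q p) p.2.2
  let z := M.pair g (M.pair τ N)
  have hz₁ : M.map (fun p => p.1) z = g := M.map_fst_pair _ _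
  have hz₂ : M.map (fun p => p.2.1) z = τ := by
    rw [← M.map_comp Prod.fst Prod.snd, M.map_snd_pair, M.map_fst_pair]
  have hz₃ : M.map (fun p => p.2.2) z = N := by
    rw [← M.map_comp Prod.snd Prod.snd, M.map_snd_pair, M.map_snd_pair]
  have hQ : ∀ i, M.Holds (fun p => Q p i) z := fun i => by
    have hi : M.map (fun p : (ℕ → X) × T × ℕ => p.1 i) z = s i := by
      rw [← hg i, ← hz₁, M.map_comp]
    refine (holds_and _ _ _).2 ⟨?_, ?_⟩
    · exact (holds_map (P i) (fun p => p.1 i) z).1 (hi ▸ (hs i).2)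
    · rw [holds_eq, hz₂, ← (hs i).1, ← hi, M.map_comp]
  have hN' : ∀ i, M.Holds (fun p : (ℕ → X) × T × ℕ => i ≤ p.2.2) z := fun i =>
    (holds_map (fun n => i ≤ n) (fun p => p.2.2) z).1 (hz₃ ▸ holds_le_of_unlimited hN i)
  refine ⟨M.map (fun p => p.1 (k p)) z, ?_, fun n => ?_⟩
  · rw [M.map_comp]
    conv_rhs => rw [← hz₂]
    exact (holds_eq _ _ _).1 ((hQ 0).mono₂ (hN' 0) fun p h₁ h₂ =>
      (Nat.findGreatest_spec (P := Q p) h₂ h₁).2)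
  · refine (holds_map _ _ _).2 ((hQ n).mono₂ (hN' n) fun p h₁ h₂ => ?_)
    exact hP n _ (Nat.le_findGreatest h₂ h₁) _ (Nat.findGreatest_spec (P := Q p) h₂ h₁).1

theorem exists_fholds_of_antitone (P : ℕ → ∀ t, C t → Prop)
    (hP : ∀ i j, i ≤ j → ∀ t a, P j t a → P i t a)
    (h : ∀ n, ∃ x : M.Fiber C τ, FHolds (P n) x) : ∃ x : M.Fiber C τ, ∀ n, FHolds (P n) x := by
  obtain ⟨x, hx, hx'⟩ := exists_holds_of_antitone (M := M) (τ := τ) Sigma.fst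
    (fun n (p : Σ t, C t) => P n p.1 p.2) (fun i j hij p => hP i j hij p.1 p.2)
    (fun n => (h n).elim fun x hx => ⟨x.1, x.2, hx⟩)
  exact ⟨⟨x, hx⟩, hx'⟩

end Saturation

section HullElements

variable {M : NonstandardExtension.{u}} {T : Type} {B : T → Type} [∀ t, CStarAlgebra (B t)]
  {τ : M.Ext T} {E : T → Type}

theorem fsub_eq (g h : ∀ t, E t → B t) (w : M.Fiber E τ) :
    fmap g w - fmap h w = fmap (fun t a => g t a - h t a) w := by
  rw [sub_eq_add_neg, fneg_eq, fadd_eq]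
  simp only [sub_eq_add_neg]

variable (M B τ) in
/-- The canonical map from the elements of limited norm to the infinitesimal hull. -/
noncomputable abbrev toHull : M.Lim B τ →+* M.Hull B τ := Ideal.Quotient.mk (M.Infinitesimals B τ)

theorem toHull_eq_iff {x y : M.Lim B τ} :
    toHull M B τ x = toHull M B τ y ↔ IsInfinitesimal (x - y : M.Fiber B τ) :=
  Ideal.Quotient.eq

theorem toHull_star (x : M.Lim B τ) : toHull M B τ (star x) = star (toHull M B τ x) := rfl

theorem toHull_algebraMap (c : ℂ) :
    toHull M B τ (algebraMap ℂ _ c) = algebraMap ℂ (M.Hull B τ) c := rfl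

end HullElements

/-! ### From internal embeddings to an embedding into the hull -/

section Embedding

/-- The factor 2 makes it unnecessary for the distance to be attained: any factor above 1 leaves
room when the distance is positive. -/
theorem StarSubalgebra.exists_norm_sub_le {A : Type v} [CStarAlgebra A] (S : StarSubalgebra ℂ A)
    (hS : IsClosed (S : Set A)) (a : A) : ∃ r : S, ∀ y : S, ‖a - r‖ ≤ 2 * ‖a - y‖ := by
  by_cases ha : a ∈ S
  · exact ⟨⟨a, ha⟩, fun y => by simp⟩
  · have hne : (S : Set A).Nonempty := ⟨1, one_mem S⟩
    have hpos : 0 < Metric.infDist a S := (hS.notMem_iff_infDist_pos hne).1 ha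
    obtain ⟨r, hr, hlt⟩ := (Metric.infDist_lt_iff hne).1
      (show Metric.infDist a S < 2 * Metric.infDist a S by linarith)
    refine ⟨⟨r, hr⟩, fun y => ?_⟩
    rw [← dist_eq_norm, ← dist_eq_norm]
    exact hlt.le.trans (mul_le_mul_of_nonneg_left (Metric.infDist_le_dist_of_mem y.2) zero_le_two)

variable {A : Type v} [CStarAlgebra A] {𝒜 : ℕ → StarSubalgebra ℂ A}

/-- Extensions are formed only of sets in `Type`. Since `A` is separable, it embeds isometrically in
a space of bounded sequences and has a copy there. -/
theorem small_of_dense_iUnion [∀ i, FiniteDimensional ℂ (𝒜 i)]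
    (hdense : closure (⋃ i, (𝒜 i : Set A)) = Set.univ) : Small.{0} A := by
  have hsep : TopologicalSpace.IsSeparable (Set.univ : Set A) := by
    rw [← hdense]
    refine (TopologicalSpace.IsSeparable.iUnion fun i => ?_).closure
    have : TopologicalSpace.IsSeparable (Set.range (Subtype.val : 𝒜 i → A)) := by
      have : ProperSpace (𝒜 i) := FiniteDimensional.proper ℂ (𝒜 i)
      exact TopologicalSpace.isSeparable_range continuous_subtype_val
    rwa [Subtype.range_coe] at this
  have := TopologicalSpace.isSeparable_univ_iff.1 hsep
  obtain ⟨f, hf⟩ := KuratowskiEmbedding.exists_isometric_embedding A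
  exact small_of_injective hf.injective

theorem exists_approx₂ (hmono : Monotone 𝒜) (hdense : closure (⋃ i, (𝒜 i : Set A)) = Set.univ)
    (a b : A) {δ : ℝ} (hδ : 0 < δ) : ∃ i, ∃ y z : 𝒜 i, ‖a - y‖ ≤ δ ∧ ‖b - z‖ ≤ δ := by
  have key : ∀ c : A, ∃ i, ∃ y ∈ 𝒜 i, ‖c - y‖ ≤ δ := fun c => by
    have hc : c ∈ closure (⋃ i, (𝒜 i : Set A)) := hdense ▸ Set.mem_univ c
    obtain ⟨y, hy, hlt⟩ := Metric.mem_closure_iff.1 hc δ hδ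
    obtain ⟨i, hi⟩ := Set.mem_iUnion.1 hy
    exact ⟨i, y, hi, by rw [← dist_eq_norm]; exact hlt.le⟩
  obtain ⟨i, y, hy, hay⟩ := key a
  obtain ⟨j, z, hz, hbz⟩ := key b
  exact ⟨max i j, ⟨y, hmono (le_max_left i j) hy⟩, ⟨z, hmono (le_max_right i j) hz⟩, hay, hbz⟩

/-- `f` is within a constant multiple of the distance to `S` of an isometric ⋆-homomorphism
defined on `S`. -/
def IsApproxEmbedding (S : StarSubalgebra ℂ A) {B : Type*} [CStarAlgebra B] (f : A → B) : Prop :=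
  ∃ ρ : S →⋆ₐ[ℂ] B, (∀ y, ‖ρ y‖ = ‖y‖) ∧ ∀ (a : A) (y : S), ‖f a - ρ y‖ ≤ 3 * ‖a - y‖

theorem IsApproxEmbedding.mono {S S' : StarSubalgebra ℂ A} (h : S ≤ S') {B : Type*}
    [CStarAlgebra B] {f : A → B} (hf : IsApproxEmbedding S' f) : IsApproxEmbedding S f := by
  obtain ⟨ρ, hρ, hf⟩ := hf
  exact ⟨ρ.comp (StarSubalgebra.inclusion h), fun y => hρ _, fun a y => hf a _⟩

/-- The map is `ρ` after a nearly best approximation `r`. As an injective ⋆-homomorphism `ρ` is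
isometric, and `‖r a - y‖ ≤ ‖a - y‖ + ‖a - r a‖` gives the constant `3 = 1 + 2`. -/
theorem exists_isApproxEmbedding {S : StarSubalgebra ℂ A} [FiniteDimensional ℂ S] {B : Type*}
    [CStarAlgebra B] (h : ∃ ρ : S →⋆ₐ[ℂ] B, Function.Injective ρ) :
    ∃ f : A → B, IsApproxEmbedding S f := by
  obtain ⟨ρ, hρ⟩ := h
  have hS : IsClosed (S : Set A) :=
    Submodule.closed_of_finiteDimensional (Subalgebra.toSubmodule S.toSubalgebra)
  have hiso : ∀ y, ‖ρ y‖ = ‖y‖ := fun y => by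
    have : IsClosed (S : Set A) := hS
    exact NonUnitalStarAlgHom.norm_map ρ hρ y
  choose r hr using StarSubalgebra.exists_norm_sub_le S hS
  refine ⟨fun a => ρ (r a), ρ, hiso, fun a y => ?_⟩
  rw [← map_sub, hiso]
  calc ‖r a - y‖ = ‖(a - y) - (a - r a)‖ := by
        rw [sub_sub_sub_cancel_left]
        exact S.toSubalgebra.toSubmodule.coe_norm _
    _ ≤ ‖a - y‖ + ‖a - r a‖ := norm_sub_le _ _
    _ ≤ 3 * ‖a - y‖ := by linarith [hr a y]

section Estimates

variable {S : StarSubalgebra ℂ A} {B : Type*} [CStarAlgebra B] {f : A → B}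

/-- Scalars lie in `S`, at distance 0 from it, so there is no error. -/
theorem IsApproxEmbedding.map_algebraMap (hf : IsApproxEmbedding S f) (c : ℂ) :
    f (algebraMap ℂ A c) = algebraMap ℂ B c := by
  obtain ⟨ρ, -, hf⟩ := hf
  have h := hf (algebraMap ℂ A c) (algebraMap ℂ S c)
  have e : ((algebraMap ℂ S c : S) : A) = algebraMap ℂ A c := rfl
  rw [e, sub_self, norm_zero, mul_zero, AlgHomClass.commutes] at h
  exact sub_eq_zero.1 (norm_le_zero_iff.1 h)

theorem IsApproxEmbedding.norm_map_bounds (hf : IsApproxEmbedding S f) {a : A} {y : S} {δ : ℝ}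
    (h : ‖a - y‖ ≤ δ) : ‖f a‖ ≤ ‖a‖ + 4 * δ ∧ ‖a‖ - 4 * δ ≤ ‖f a‖ := by
  obtain ⟨ρ, hρ, hf⟩ := hf
  have h₁ := hf a y
  have h₂ : ‖ρ y‖ = ‖(y : A)‖ := hρ y
  have h₃ := abs_le.1 (abs_norm_sub_norm_le a (y : A))
  have h₄ := abs_le.1 (abs_norm_sub_norm_le (f a) (ρ y))
  constructor <;> linarith [h₃.1, h₃.2, h₄.1, h₄.2]

theorem IsApproxEmbedding.norm_map_star_sub_le (hf : IsApproxEmbedding S f) {a : A} {y : S} {δ : ℝ}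
    (h : ‖a - y‖ ≤ δ) : ‖f (star a) - star (f a)‖ ≤ 6 * δ := by
  obtain ⟨ρ, hρ, hf⟩ := hf
  have h₁ := hf a y
  have h₂ := hf (star a) (star y)
  rw [StarMemClass.coe_star, ← star_sub, norm_star, map_star] at h₂
  have h₃ : ‖star (f a) - star (ρ y)‖ ≤ 3 * ‖a - y‖ := by rwa [← star_sub, norm_star]
  have := norm_sub_le_norm_sub_add_norm_sub (f (star a)) (star (ρ y)) (star (f a))
  rw [norm_sub_rev (star (ρ y))] at this
  linarith

theorem IsApproxEmbedding.norm_map_add_sub_le (hf : IsApproxEmbedding S f) {a b : A} {y z : S}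
    {δ : ℝ} (h : ‖a - y‖ ≤ δ) (h' : ‖b - z‖ ≤ δ) : ‖f (a + b) - (f a + f b)‖ ≤ 12 * δ := by
  obtain ⟨ρ, hρ, hf⟩ := hf
  have h₁ := hf a y
  have h₂ := hf b z
  have h₃ := hf (a + b) (y + z)
  have e : a + b - ((y + z : S) : A) = (a - y) + (b - z) := by
    rw [AddMemClass.coe_add]
    abel
  rw [e] at h₃
  have h₄ := norm_add_le (a - y) (b - z)
  have e' : f (a + b) - (f a + f b) = (f (a + b) - ρ (y + z)) - (f a - ρ y) - (f b - ρ z) := by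
    rw [map_add]
    abel
  rw [e']
  have h₅ := norm_sub_le (f (a + b) - ρ (y + z) - (f a - ρ y)) (f b - ρ z)
  have h₆ := norm_sub_le (f (a + b) - ρ (y + z)) (f a - ρ y)
  linarith

/-- The factors are compared with `ρ y` and `ρ z`; the hypothesis `δ ≤ 1` absorbs the quadratic
terms, and `18 = 3 + 12 + 3` collects the constants of `h₄` (tripled), `h₅` and `h₆`. -/
theorem IsApproxEmbedding.norm_map_mul_sub_le (hf : IsApproxEmbedding S f) {a b : A} {y z : S}
    {δ : ℝ} (h : ‖a - y‖ ≤ δ) (h' : ‖b - z‖ ≤ δ) (hδ : δ ≤ 1) :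
    ‖f (a * b) - f a * f b‖ ≤ (6 * ‖a‖ + 6 * ‖b‖ + 18) * δ := by
  have hb := (hf.norm_map_bounds h).1
  obtain ⟨ρ, hρ, hf⟩ := hf
  have h₁ := hf a y
  have h₂ := hf b z
  have h₃ := hf (a * b) (y * z)
  have hz : ‖ρ z‖ = ‖(z : A)‖ := hρ z
  have hz' : ‖(z : A)‖ ≤ ‖b‖ + δ := by
    linarith [(abs_le.1 (abs_norm_sub_norm_le b (z : A))).1]
  have hδ0 : 0 ≤ δ := (norm_nonneg _).trans h
  have e : a * b - ((y * z : S) : A) = a * (b - z) + (a - y) * z := by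
    rw [MulMemClass.coe_mul]
    noncomm_ring
  have h₄ : ‖a * b - ((y * z : S) : A)‖ ≤ ‖a‖ * δ + δ * (‖b‖ + 1) := by
    rw [e]
    refine (norm_add_le _ _).trans (add_le_add ((norm_mul_le _ _).trans ?_)
      ((norm_mul_le _ _).trans ?_))
    · gcongr
    · gcongr
      linarith
  have e' : f (a * b) - f a * f b =
      (f (a * b) - ρ (y * z)) - (f a * (f b - ρ z) + (f a - ρ y) * ρ z) := by
    rw [map_mul]
    noncomm_ring
  have h₅ : ‖f a * (f b - ρ z)‖ ≤ (‖a‖ + 4) * (3 * δ) := by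
    refine (norm_mul_le _ _).trans ?_
    gcongr
    · linarith
    · linarith
  have h₆ : ‖(f a - ρ y) * ρ z‖ ≤ (3 * δ) * (‖b‖ + 1) := by
    refine (norm_mul_le _ _).trans ?_
    gcongr
    · linarith
    · linarith
  rw [e']
  have h₇ := norm_sub_le (f (a * b) - ρ (y * z)) (f a * (f b - ρ z) + (f a - ρ y) * ρ z)
  have h₈ := norm_add_le (f a * (f b - ρ z)) ((f a - ρ y) * ρ z)
  nlinarith

end Estimates

variable {M : NonstandardExtension.{u}} {T : Type} {B : T → Type} [∀ t, CStarAlgebra (B t)]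
  {τ : M.Ext T}

/-- If every `𝒜 i` embeds internally into `𝔅`, then `A` embeds into the hull of `𝔅`. -/
theorem exists_injective_starAlgHom_hull (hmono : Monotone 𝒜)
    [∀ i, FiniteDimensional ℂ (𝒜 i)] (hdense : closure (⋃ i, (𝒜 i : Set A)) = Set.univ)
    (h : ∀ i, M.Holds (fun t => ∃ ρ : 𝒜 i →⋆ₐ[ℂ] B t, Function.Injective ρ) τ) :
    ∃ φ : A →⋆ₐ[ℂ] M.Hull B τ, Function.Injective φ := by
  have := small_of_dense_iUnion hdense
  let σ : A ≃ Shrink.{0} A := equivShrink A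
  -- Each condition is satisfied by some internal map, and `IsApproxEmbedding.mono` makes the
  -- conditions decreasing; one internal map satisfies them all.
  obtain ⟨x, hx⟩ := exists_fholds_of_antitone (M := M) (τ := τ)
    (C := fun t => Shrink.{0} A → B t)
    (fun i t f => IsApproxEmbedding (𝒜 i) fun a => f (σ a))
    (fun i j hij t f hf => hf.mono (hmono hij))
    (fun i => exists_fholds_of_holds ((h i).mono fun t ht => by
      obtain ⟨f, hf⟩ := exists_isApproxEmbedding ht
      exact ⟨fun a => f (σ.symm a), by simpa using hf⟩))
  let F : A → M.Fiber B τ := fun a => fmap (fun _ f => f (σ a)) x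
  have hlim : ∀ a, F a ∈ M.Lim B τ := fun a => by
    obtain ⟨i, y, -, hy, -⟩ := exists_approx₂ hmono hdense a a one_pos
    refine ⟨‖a‖ + 4 * 1, (fholds_fmap _ _ _).2 ?_⟩
    exact (hx i).mono fun p hp => (hp.norm_map_bounds hy).1
  let φ : A → M.Hull B τ := fun a => toHull M B τ ⟨F a, hlim a⟩
  have hmap : ∀ c, φ (algebraMap ℂ A c) = algebraMap ℂ _ c := fun c => by
    have : F (algebraMap ℂ A c) = algebraMap ℂ _ c := by
      rw [Algebra.algebraMap_eq_smul_one (A := M.Fiber B τ), fone_eq x, fsmul_eq]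
      refine Subtype.ext ((holds_eq _ _ _).1 ((hx 0).mono fun p hp => ?_))
      have e : p.2 (σ (algebraMap ℂ A c)) = c • 1 :=
        hp.map_algebraMap c |>.trans (Algebra.algebraMap_eq_smul_one c)
      exact congrArg (fun b => (⟨p.1, b⟩ : Σ t, B t)) e
    rw [← toHull_algebraMap]
    exact congrArg _ (Subtype.ext this)
  refine ⟨{ toFun := φ
            map_one' := by simpa using hmap 1
            map_zero' := by simpa using hmap 0
            map_mul' := fun a b => ?_
            map_add' := fun a b => ?_
            commutes' := hmap
            map_star' := fun a => ?_ }, ?_⟩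
  · change _ = toHull M B τ _ * toHull M B τ _
    rw [← map_mul, toHull_eq_iff]
    intro r hr
    have hC : 0 < 6 * ‖a‖ + 6 * ‖b‖ + 18 := by positivity
    obtain ⟨i, y, z, hy, hz⟩ := exists_approx₂ hmono hdense a b
      (lt_min one_pos (div_pos hr hC))
    change NormLE (F (a * b) - F a * F b) r
    rw [fmul_eq, fsub_eq]
    refine (fholds_fmap _ _ _).2 ((hx i).mono fun p hp => ?_)
    refine (hp.norm_map_mul_sub_le hy hz (min_le_left _ _)).trans ?_
    refine (mul_le_mul_of_nonneg_left (min_le_right _ _) hC.le).trans ?_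
    rw [mul_div_cancel₀ _ hC.ne']
  · change _ = toHull M B τ _ + toHull M B τ _
    rw [← map_add, toHull_eq_iff]
    intro r hr
    obtain ⟨i, y, z, hy, hz⟩ := exists_approx₂ hmono hdense a b (show 0 < r / 12 by positivity)
    change NormLE (F (a + b) - (F a + F b)) r
    rw [fadd_eq, fsub_eq]
    refine (fholds_fmap _ _ _).2 ((hx i).mono fun p hp => ?_)
    exact (hp.norm_map_add_sub_le hy hz).trans (by linarith)
  · change _ = star (toHull M B τ _)
    rw [← toHull_star, toHull_eq_iff]
    intro r hr
    obtain ⟨i, y, -, hy, -⟩ := exists_approx₂ hmono hdense a a (show 0 < r / 6 by positivity)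
    change NormLE (F (star a) - star (F a)) r
    rw [fstar_eq, fsub_eq]
    refine (fholds_fmap _ _ _).2 ((hx i).mono fun p hp => ?_)
    exact (hp.norm_map_star_sub_le hy).trans (by linarith)
  · rw [injective_iff_map_eq_zero]
    intro a ha
    by_contra hne
    have hpos : 0 < ‖a‖ := norm_pos_iff.2 hne
    have h0 : toHull M B τ ⟨F a, hlim a⟩ = toHull M B τ 0 := ha.trans (map_zero _).symm
    rw [toHull_eq_iff] at h0
    have h1 := h0 (‖a‖ / 4) (by positivity)
    change NormLE (F a - 0) _ at h1
    rw [sub_zero] at h1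
    -- This accuracy bounds the norm of the image below by `3 ‖a‖ / 4`, against the bound `‖a‖ / 4`
    -- from vanishing in the hull.
    obtain ⟨i, y, -, hy, -⟩ := exists_approx₂ hmono hdense a a (show 0 < ‖a‖ / 16 by positivity)
    obtain ⟨p, hp, hp'⟩ := ((holds_and _ _ _).2 ⟨hx i, (fholds_fmap _ _ _).1 h1⟩).exists_of
    linarith [(hp.norm_map_bounds hy).2]

end Embedding

end NonstandardExtension

/-! ### Spectral projections for a finite spectrum -/

section SpectralProjections

open Polynomial

variable {B : Type v} [CStarAlgebra B] {n : ℕ}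

/-- The spectral projection of `b` onto the part of the spectrum which `κ` maps to `k`. -/
noncomputable def spectralProj (κ : ℂ → Fin n) (b : B) (k : Fin n) : B :=
  cfc (fun z => if κ z = k then (1 : ℂ) else 0) b

theorem norm_spectralProj_le (κ : ℂ → Fin n) (b : B) (k : Fin n) : ‖spectralProj κ b k‖ ≤ 1 := by
  refine norm_cfc_le zero_le_one fun z _ => ?_
  split_ifs <;> simp

variable [FiniteDimensional ℂ B]

/-- The spectrum is finite, so the functional calculus applies to discontinuous functions such as
indicators. -/
theorem continuousOn_spectrum (f : ℂ → ℂ) (b : B) : ContinuousOn f (spectrum ℂ b) := by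
  have h : (spectrum ℂ b).Finite :=
    (Module.End.finite_spectrum (LinearMap.mulLeft ℂ b)).subset (spectrum_subset_mulLeft b)
  exact h.continuousOn f

theorem isIdempotentElem_spectralProj (κ : ℂ → Fin n) (b : B) (k : Fin n) :
    IsIdempotentElem (spectralProj κ b k) := by
  rw [IsIdempotentElem, spectralProj,
    ← cfc_mul _ _ b (continuousOn_spectrum _ b) (continuousOn_spectrum _ b)]
  simp only [mul_ite, mul_one, mul_zero]
  congr 1
  ext z
  split_ifs <;> rfl

theorem sum_spectralProj (κ : ℂ → Fin n) {b : B} (hb : IsStarNormal b) :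
    ∑ k, spectralProj κ b k = 1 := by
  unfold spectralProj
  rw [← cfc_sum_univ _ b fun k => continuousOn_spectrum _ b, ← cfc_one ℂ b]
  congr 1
  ext z
  simp

/-- On the part of the spectrum that `κ` sends to `k`, the point `c k` is a nearest one, so `‖z - c
k‖ ^ n` is at most the product of all `‖z - c j‖`, which the norm of the polynomial in `b` bounds.
-/
theorem norm_sub_mul_spectralProj_le {κ : ℂ → Fin n} {c : Fin n → ℂ}
    (hκ : ∀ z j, ‖z - c (κ z)‖ ≤ ‖z - c j‖) {b : B} (hb : IsStarNormal b) {r : ℝ} (hr : 0 ≤ r)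
    (h : ‖aeval b (∏ j, (X - C (c j)))‖ ≤ r ^ n) (k : Fin n) :
    ‖(b - algebraMap ℂ B (c k)) * spectralProj κ b k‖ ≤ r := by
  have e : b - algebraMap ℂ B (c k) = cfc (X - C (c k)).eval b := by
    rw [cfc_polynomial _ b hb]
    simp
  rw [e, spectralProj, ← cfc_mul _ _ b (continuousOn_spectrum _ b) (continuousOn_spectrum _ b)]
  refine norm_cfc_le hr fun z hz => ?_
  by_cases hk : κ z = k
  · have h₁ : ‖(∏ j, (X - C (c j))).eval z‖ ≤ r ^ n := by
      refine le_trans ?_ h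
      rw [← cfc_polynomial _ b hb]
      exact norm_apply_le_norm_cfc (fun x => eval x (∏ j, (X - C (c j)))) b hz (continuousOn_spectrum _ b) hb
    rw [eval_prod, norm_prod] at h₁
    have h₂ : ‖z - c k‖ ^ n ≤ r ^ n := by
      refine le_trans ?_ h₁
      rw [← Fin.prod_const]
      refine Finset.prod_le_prod (fun _ _ => norm_nonneg _) fun j _ => ?_
      rw [← hk]
      simpa using hκ z j
    have hn : n ≠ 0 := (Fin.pos k).ne'
    simpa [hk] using (pow_le_pow_iff_left₀ (norm_nonneg _) hr hn).1 h₂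
  · simpa [hk] using hr

end SpectralProjections

/-! ### Resolutions of the identity as eigenprojections -/

section EigenProjections

variable {R : Type v} [Ring R] [Algebra ℂ R] {n : ℕ} {c : Fin n → ℂ} {E : Fin n → R}

theorem sum_smul_mul_of_orthogonal (horth : ∀ k l, k ≠ l → E k * E l = 0) (hsum : ∑ k, E k = 1)
    (k : Fin n) :
    (∑ l, c l • E l) * E k = c k • E k ∧ E k * (∑ l, c l • E l) = c k • E k := by
  have hid : E k * E k = E k := by
    have h : (∑ l, E l) * E k = E k := by rw [hsum, one_mul]
    rwa [Finset.sum_mul, Finset.sum_eq_single k (fun l _ hl => horth l k hl) (by simp)] at h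
  constructor
  · rw [Finset.sum_mul, Finset.sum_eq_single k (fun l _ hl => by
      rw [smul_mul_assoc, horth l k hl, smul_zero]) (by simp), smul_mul_assoc, hid]
  · rw [Finset.mul_sum, Finset.sum_eq_single k (fun l _ hl => by
      rw [mul_smul_comm, horth k l hl.symm, smul_zero]) (by simp), mul_smul_comm, hid]

open Polynomial in
theorem aeval_prod_eq_zero_of_orthogonal (horth : ∀ k l, k ≠ l → E k * E l = 0)
    (hsum : ∑ k, E k = 1) : aeval (∑ l, c l • E l) (∏ j, (X - C (c j))) = 0 := by
  rw [← mul_one (aeval _ _), ← hsum, Finset.mul_sum]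
  refine Finset.sum_eq_zero fun k _ => ?_
  rw [← Finset.prod_erase_mul _ _ (Finset.mem_univ k), map_mul, mul_assoc, map_sub, aeval_X, aeval_C,
    sub_mul, (sum_smul_mul_of_orthogonal horth hsum k).1, Algebra.algebraMap_eq_smul_one,
    smul_mul_assoc, one_mul, sub_self, mul_zero]

/-- A resolution of the identity is determined by the element it diagonalizes. -/
theorem eq_of_eigenprojections (hc : Function.Injective c) (horth : ∀ k l, k ≠ l → E k * E l = 0)
    (hsum : ∑ k, E k = 1) {p : Fin n → R} (hp : ∑ k, p k = 1)
    (h : ∀ k, (∑ l, c l • E l - algebraMap ℂ R (c k)) * p k = 0) (k : Fin n) : p k = E k := by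
  have key : ∀ l m, l ≠ m → E l * p m = 0 := by
    intro l m hlm
    have h₁ := h m
    rw [sub_mul, sub_eq_zero, Algebra.algebraMap_eq_smul_one, smul_mul_assoc, one_mul] at h₁
    -- The diagonalized element, placed between `E l` and `p m`, acts by `c l` on one side and by `c
    -- m` on the other.
    have h₂ : c l • (E l * p m) = c m • (E l * p m) := by
      rw [← smul_mul_assoc, ← (sum_smul_mul_of_orthogonal horth hsum l).2, mul_assoc, h₁,
        mul_smul_comm]
    rw [← sub_eq_zero, ← sub_smul, smul_eq_zero] at h₂
    exact h₂.resolve_left (sub_ne_zero.2 (hc.ne hlm))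
  have h₁ : E k * p k = p k := by
    have : (∑ l, E l) * p k = p k := by rw [hsum, one_mul]
    rwa [Finset.sum_mul, Finset.sum_eq_single k (fun l _ hl => key l k hl) (by simp)] at this
  have h₂ : E k * p k = E k := by
    have : E k * ∑ l, p l = E k := by rw [hp, mul_one]
    rwa [Finset.mul_sum, Finset.sum_eq_single k (fun l _ hl => key k l hl.symm) (by simp)] at this
  rw [← h₁, h₂]

end EigenProjections

/-! ### Matrix units -/

section MatrixUnits

/-- Matrix units in a finite dimensional C⋆-algebra: the diagonal ones `E` and those `V` of the first
rows. -/
theorem exists_matrixUnits {F : Type v} [CStarAlgebra F] [FiniteDimensional ℂ F] :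
    ∃ E V : (Σ e : MinCentralProj F, Fin (dimProj e)) → F,
      (∀ k, star (E k) = E k) ∧ (∀ k l, k ≠ l → E k * E l = 0) ∧ (∑ k, E k = 1) ∧
      (∀ k, star (V k) * E ⟨k.1, 0, dimProj_pos k.1⟩ * V k = E k) ∧
      (∀ k, V k * E k * star (V k) = E ⟨k.1, 0, dimProj_pos k.1⟩) ∧ ∀ k, E k ≠ 0 := by
  classical
  obtain ⟨Φ, -⟩ := exists_starAlgEquiv_pi (R := F)
  let P := ∀ e : MinCentralProj F, Matrix (Fin (dimProj e)) (Fin (dimProj e)) ℂ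
  let u : ∀ e : MinCentralProj F, Fin (dimProj e) → Fin (dimProj e) → P :=
    fun e i j => Pi.single e (Matrix.single i j 1)
  have hmul : ∀ e i j k, u e i j * u e j k = u e i k := fun e i j k => by
    simp only [u]
    rw [← Pi.single_mul, Matrix.single_mul_single_same, one_mul]
  have hstar : ∀ e i j, star (u e i j) = u e j i := fun e i j => by
    simp only [u]
    rw [← Pi.single_star, Matrix.star_eq_conjTranspose, Matrix.conjTranspose_single, star_one]
  refine ⟨fun k => Φ.symm (u k.1 k.2 k.2), fun k => Φ.symm (u k.1 ⟨0, dimProj_pos k.1⟩ k.2),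
    fun k => ?_, ?_, ?_, fun k => ?_, fun k => ?_, fun k => ?_⟩
  · rw [← map_star, hstar]
  · rintro ⟨e, i⟩ ⟨f, j⟩ hne
    dsimp only
    rw [← map_mul]
    refine (congrArg Φ.symm ?_).trans (map_zero _)
    by_cases hef : e = f
    · subst hef
      have hij : i ≠ j := fun h => hne (by rw [h])
      simp only [u]
      rw [← Pi.single_mul, Matrix.single_mul_single_of_ne _ _ _ _ hij, Pi.single_zero]
    · ext1 g
      simp only [u, Pi.mul_apply, Pi.zero_apply]
      by_cases hg : g = e
      · subst hg
        rw [Pi.single_eq_of_ne hef, mul_zero]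
      · rw [Pi.single_eq_of_ne hg, zero_mul]
  · rw [← map_sum, Fintype.sum_sigma]
    refine (congrArg Φ.symm ?_).trans (map_one _)
    ext1 g
    rw [Finset.sum_apply, Finset.sum_eq_single g]
    · rw [Finset.sum_apply]
      simp only [u, Pi.single_eq_same, Pi.one_apply]
      exact Matrix.sum_single_one
    · intro e _ he
      rw [Finset.sum_apply]
      exact Finset.sum_eq_zero fun i _ => Pi.single_eq_of_ne he.symm _
    · simp
  · rw [← map_star, ← map_mul, ← map_mul, hstar, hmul, hmul]
  · rw [← map_star, ← map_mul, ← map_mul, hstar, hmul, hmul]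
  · intro h
    have h' := EquivLike.injective Φ.symm (h.trans (map_zero Φ.symm).symm)
    have h'' := congrFun (congrFun (congrFun h' k.1) k.2) k.2
    simp [u] at h''

end MatrixUnits

/-! ### Lifting projections and matrix units from the hull -/

namespace NonstandardExtension

section Lifting

variable {M : NonstandardExtension.{u}} {T : Type} {B E : T → Type} [∀ t, CStarAlgebra (B t)]
  {τ : M.Ext T}

theorem falgebraMap_eq (c : ℂ) (w : M.Fiber E τ) :
    algebraMap ℂ (M.Fiber B τ) c = fmap (fun _ _ => algebraMap ℂ _ c) w := by
  simp only [Algebra.algebraMap_eq_smul_one]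
  rw [fone_eq w, fsmul_eq]

theorem aeval_fmap (q : Polynomial ℂ) (g : ∀ t, E t → B t) (w : M.Fiber E τ) :
    Polynomial.aeval (fmap g w) q = fmap (fun t a => Polynomial.aeval (g t a) q) w := by
  induction q using Polynomial.induction_on with
  | C c => simp only [Polynomial.aeval_C, falgebraMap_eq c w]
  | add p q hp hq => simp only [map_add, hp, hq, fadd_eq]
  | monomial k c ih =>
    simp only [pow_succ, ← mul_assoc, map_mul _ _ Polynomial.X, Polynomial.aeval_X]
    rw [ih, fmul_eq]

theorem fsum_eq {ι : Type*} (s : Finset ι) (g : ι → ∀ t, E t → B t) (w : M.Fiber E τ) :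
    ∑ k ∈ s, fmap (g k) w = fmap (fun t a => ∑ k ∈ s, g k t a) w := by
  classical
  induction s using Finset.induction_on with
  | empty => simpa using fzero_eq w
  | insert k s hk ih =>
    rw [Finset.sum_insert hk, ih, fadd_eq]
    simp only [Finset.sum_insert hk]

theorem hull_star_smul (c : ℂ) (x : M.Hull B τ) : star (c • x) = star c • star x := by
  obtain ⟨y, rfl⟩ := Ideal.Quotient.mk_surjective x
  exact congrArg (toHull M B τ) (star_smul c y)

theorem toHull_eq_zero_iff {x : M.Lim B τ} :
    toHull M B τ x = 0 ↔ IsInfinitesimal (x : M.Fiber B τ) := Ideal.Quotient.eq_zero_iff_mem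

open Polynomial in
theorem toHull_aeval (x : M.Lim B τ) (q : ℂ[X]) :
    toHull M B τ (aeval x q) = aeval (toHull M B τ x) q :=
  (aeval_algHom_apply (Ideal.Quotient.mkₐ ℂ (M.Infinitesimals B τ)) x q).symm

open Polynomial in
theorem coe_aeval_lim (x : M.Lim B τ) (q : ℂ[X]) :
    ((aeval x q : M.Lim B τ) : M.Fiber B τ) = aeval (x : M.Fiber B τ) q :=
  (aeval_algHom_apply (M.Lim B τ).toSubalgebra.val x q).symm

/-- Lifting of a resolution of the identity from the hull to exact internal projections. -/
theorem exists_lift_projections [∀ t, FiniteDimensional ℂ (B t)] {n : ℕ} (hn : 0 < n)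
    (p : Fin n → M.Hull B τ) (hstar : ∀ k, star (p k) = p k)
    (horth : ∀ k l, k ≠ l → p k * p l = 0) (hsum : ∑ k, p k = 1) :
    ∃ (κ : ℂ → Fin n) (w : M.Fiber B τ)
      (hlim : ∀ k, fmap (fun _ a => spectralProj κ (a + star a) k) w ∈ M.Lim B τ),
      ∀ k, toHull M B τ ⟨_, hlim k⟩ = p k := by
  -- Distinct real eigenvalues encode the whole resolution in one self-adjoint element `H`.
  let c : Fin n → ℂ := fun k => (k : ℕ)
  have hc : Function.Injective c := fun k l h => Fin.ext (Nat.cast_injective h)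
  have hne : (Finset.univ : Finset (Fin n)).Nonempty := ⟨⟨0, hn⟩, Finset.mem_univ _⟩
  choose κ hκ using fun z => Finset.exists_min_image Finset.univ (fun k => ‖z - c k‖) hne
  have hκ' : ∀ z j, ‖z - c (κ z)‖ ≤ ‖z - c j‖ := fun z j => (hκ z).2 j (Finset.mem_univ j)
  set H : M.Hull B τ := ∑ k, c k • p k with hH
  -- A lift of `H / 2` plus its adjoint is a lift of `H` that is exactly self-adjoint in every
  -- fibre.
  obtain ⟨h, hh⟩ := Ideal.Quotient.mk_surjective ((1 / 2 : ℂ) • H)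
  change toHull M B τ h = _ at hh
  have hstarH : star ((1 / 2 : ℂ) • H) = (1 / 2 : ℂ) • H := by
    rw [hull_star_smul, hH, star_sum]
    simp only [hull_star_smul, hstar]
    congr 1
    · simp
    · simp [c]
  let b : M.Lim B τ := h + star h
  have hb : toHull M B τ b = H := by
    rw [map_add, toHull_star, hh, hstarH, ← add_smul]
    norm_num
  have hbv : (b : M.Fiber B τ) = fmap (fun _ a => a + star a) h.1 := by
    change h.1 + star h.1 = _
    conv_lhs => rw [← fmap_id h.1]
    rw [fstar_eq, fadd_eq]
  have hnormal : ∀ t (a : B t), IsStarNormal (a + star a) := fun t a =>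
    (IsSelfAdjoint.add_star_self a).isStarNormal
  have hlim : ∀ k, fmap (fun _ a => spectralProj κ (a + star a) k) h.1 ∈ M.Lim B τ := fun k =>
    ⟨1, (fholds_fmap _ _ _).2 (holds_of_forall (fun p => norm_spectralProj_le κ _ k) _)⟩
  refine ⟨κ, h.1, hlim, eq_of_eigenprojections hc horth hsum ?_ fun k => ?_⟩
  · rw [← map_sum, ← map_one (toHull M B τ)]
    refine congrArg _ (Subtype.ext ?_)
    rw [AddSubmonoidClass.coe_finsetSum]
    change ∑ k, fmap (fun _ a => spectralProj κ (a + star a) k) h.1 = 1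
    rw [fsum_eq, fone_eq h.1]
    simp only [sum_spectralProj κ (hnormal _ _)]
  · rw [← hH, ← hb, ← toHull_algebraMap, ← map_sub, ← map_mul, toHull_eq_zero_iff]
    -- This polynomial annihilates `H`, so its value at the lift is infinitesimal, in particular
    -- below `r ^ n`.
    have hq : toHull M B τ (Polynomial.aeval b (∏ j, (Polynomial.X - Polynomial.C (c j)))) = 0 := by
      rw [toHull_aeval, hb, hH, aeval_prod_eq_zero_of_orthogonal horth hsum]
    rw [toHull_eq_zero_iff, coe_aeval_lim, hbv, aeval_fmap] at hq
    intro r hr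
    change NormLE (((b : M.Fiber B τ) - algebraMap ℂ (M.Fiber B τ) (c k)) *
      fmap (fun _ a => spectralProj κ (a + star a) k) h.1) r
    rw [hbv, falgebraMap_eq (c k) h.1, fsub_eq, fmul_eq]
    refine (fholds_fmap _ _ _).2 (((fholds_fmap _ _ _).1 (hq (r ^ n) (pow_pos hr n))).mono ?_)
    exact fun q hq => norm_sub_mul_spectralProj_le hκ' (hnormal _ _) hr.le hq k

/-- A finite dimensional C⋆-subalgebra of the hull has a dimension vector which divides that of the
internal algebra. -/
theorem holds_isMultiplicity_of_injective [∀ t, FiniteDimensional ℂ (B t)] {F : Type v}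
    [CStarAlgebra F] [FiniteDimensional ℂ F] (ψ : F →⋆ₐ[ℂ] M.Hull B τ)
    (hψ : Function.Injective ψ) :
    M.Holds (fun t => ∃ Γ : MinCentralProj F → MinCentralProj (B t) → ℕ,
      IsMultiplicity (dimProj (R := F)) Γ) τ := by
  obtain ⟨e, v, hestar, horth, hsum, hv₁, hv₂, he0⟩ := exists_matrixUnits (F := F)
  let ε := Fintype.equivFin (Σ e : MinCentralProj F, Fin (dimProj e))
  set n := Fintype.card (Σ e : MinCentralProj F, Fin (dimProj e))
  rcases Nat.eq_zero_or_pos n with hn | hn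
  -- With no matrix units `F` is the zero algebra, so 1 is infinitesimal and the fibres in question
  -- are zero algebras too.
  · have hF : IsEmpty (Σ e : MinCentralProj F, Fin (dimProj e)) := Fintype.card_eq_zero_iff.1 hn
    have h1 : toHull M B τ 1 = 0 := by
      rw [map_one, ← map_one ψ, ← hsum, Finset.univ_eq_empty, Finset.sum_empty, map_zero]
    rw [toHull_eq_zero_iff] at h1
    have h2 : M.Holds (fun t => ‖(1 : B t)‖ ≤ 1 / 2) τ :=
      (holds_map _ _ _).1 (h1 (1 / 2) (by norm_num))
    refine h2.mono fun t ht => ?_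
    have h0 : (0 : B t) = 1 := by
      by_contra hne
      have : Nontrivial (B t) := ⟨0, 1, hne⟩
      rw [CStarRing.norm_one] at ht
      norm_num at ht
    have hM : IsEmpty (MinCentralProj F) := ⟨fun e => hF.false ⟨e, 0, dimProj_pos e⟩⟩
    refine ⟨fun e => hM.elim e, fun f => ?_, fun e => hM.elim e⟩
    exact absurd (by rw [← mul_one f.1, ← h0, mul_zero]) f.2.1.2.2
  obtain ⟨κ, w, hlim, hp⟩ := exists_lift_projections hn (fun k => ψ (e (ε.symm k)))
    (fun k => by rw [← map_star, hestar])
    (fun k l hkl => by rw [← map_mul, horth _ _ (ε.symm.injective.ne hkl), map_zero])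
    (by rw [← map_sum, Equiv.sum_comp ε.symm, hsum, map_one])
  -- Any lifts will do here: only the diagonal projections must be exact.
  choose V hV using fun k => Ideal.Quotient.mk_surjective (I := M.Infinitesimals B τ)
    (ψ (v (ε.symm k)))
  change ∀ k, toHull M B τ (V k) = _ at hV
  obtain ⟨y, hy⟩ := exists_ftuple fun k => (V k : M.Fiber B τ)
  obtain ⟨z, hz₁, hz₂⟩ := exists_fpair w y
  let P : ∀ t, B t × (Fin n → B t) → (Σ e : MinCentralProj F, Fin (dimProj e)) → B t :=
    fun t a k => spectralProj κ (a.1 + star a.1) (ε k)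
  let U : ∀ t, B t × (Fin n → B t) → (Σ e : MinCentralProj F, Fin (dimProj e)) → B t :=
    fun t a k => a.2 (ε k)
  have hP' : ∀ k, fmap (fun _ a => spectralProj κ (a + star a) (ε k)) w =
      fmap (fun t a => P t a k) z := fun k => by rw [← hz₁, fmap_fmap]
  have hU' : ∀ k, (V (ε k) : M.Fiber B τ) = fmap (fun t a => U t a k) z := fun k => by
    rw [← hy, ← hz₂, fmap_fmap]
  have hPl : ∀ k, fmap (fun t a => P t a k) z ∈ M.Lim B τ := fun k => hP' k ▸ hlim (ε k)
  have hP : ∀ k, toHull M B τ ⟨_, hPl k⟩ = ψ (e k) := fun k => by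
    rw [← ε.symm_apply_apply k, ← hp (ε k)]
    exact congrArg _ (Subtype.ext (by
      rw [ε.symm_apply_apply]
      exact (hP' k).symm))
  have hUl : ∀ k, fmap (fun t a => U t a k) z ∈ M.Lim B τ := fun k => hU' k ▸ (V (ε k)).2
  have hU : ∀ k, toHull M B τ ⟨_, hUl k⟩ = ψ (v k) := fun k => by
    rw [← ε.symm_apply_apply k, ← hV (ε k)]
    exact congrArg _ (Subtype.ext (by
      rw [ε.symm_apply_apply]
      exact (hU' k).symm))
  let k₀ : (Σ e : MinCentralProj F, Fin (dimProj e)) → (Σ e : MinCentralProj F, Fin (dimProj e)) :=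
    fun k => ⟨k.1, 0, dimProj_pos k.1⟩
  -- The relation is exact in the hull, so the internal error is infinitesimal; 1/2 is just a
  -- standard bound below 1.
  have h₁ : ∀ k, FHolds (fun t a => ‖P t a k - star (U t a k) * P t a (k₀ k) * U t a k‖ ≤ 1 / 2)
      z := fun k => by
    have h : toHull M B τ ⟨_, hPl k⟩ =
        toHull M B τ (star ⟨_, hUl k⟩ * ⟨_, hPl (k₀ k)⟩ * ⟨_, hUl k⟩) := by
      rw [map_mul, map_mul, toHull_star, hP, hP, hU, ← map_star, ← map_mul, ← map_mul, hv₁]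
    rw [toHull_eq_iff] at h
    have h' := h (1 / 2) (by norm_num)
    change NormLE (fmap (fun t a => P t a k) z - star (fmap (fun t a => U t a k) z) *
      fmap (fun t a => P t a (k₀ k)) z * fmap (fun t a => U t a k) z) _ at h'
    rw [fstar_eq, fmul_eq, fmul_eq, fsub_eq] at h'
    exact (fholds_fmap _ _ _).1 h'
  have h₂ : ∀ k, FHolds (fun t a => ‖P t a (k₀ k) - U t a k * P t a k * star (U t a k)‖ ≤ 1 / 2)
      z := fun k => by
    have h : toHull M B τ ⟨_, hPl (k₀ k)⟩ =
        toHull M B τ (⟨_, hUl k⟩ * ⟨_, hPl k⟩ * star ⟨_, hUl k⟩) := by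
      rw [map_mul, map_mul, toHull_star, hP, hP, hU, ← map_star, ← map_mul, ← map_mul, hv₂]
    rw [toHull_eq_iff] at h
    have h' := h (1 / 2) (by norm_num)
    change NormLE (fmap (fun t a => P t a (k₀ k)) z - fmap (fun t a => U t a k) z *
      fmap (fun t a => P t a k) z * star (fmap (fun t a => U t a k) z)) _ at h'
    rw [fstar_eq, fmul_eq, fmul_eq, fsub_eq] at h'
    exact (fholds_fmap _ _ _).1 h'
  -- A lift equal to zero would make `ψ (e k)` vanish, against injectivity.
  have h₃ : ∀ k, FHolds (fun t a => ¬ P t a k = 0) z := fun k => by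
    refine (holds_not _ _).2 fun h => he0 k (hψ ?_)
    rw [map_zero, ← hP, toHull_eq_zero_iff]
    intro r hr
    refine (fholds_fmap _ (fun t a => P t a k) _).2 (h.mono fun p hp => ?_)
    exact (norm_eq_zero.2 hp).trans_le hr.le
  have key := (holds_and _ _ _).2 ⟨(holds_forall_finite _ _).2 h₁,
    (holds_and _ _ _).2 ⟨(holds_forall_finite _ _).2 h₂, (holds_forall_finite _ _).2 h₃⟩⟩
  refine FHolds.holds_exists (C := fun t => B t × (Fin n → B t)) (w := z)
    (P := fun t _ => ∃ Γ : MinCentralProj F → MinCentralProj (B t) → ℕ,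
      IsMultiplicity (dimProj (R := F)) Γ) (key.mono fun p hp => ?_) |>.mono fun t ht => ht.choose_spec
  have hn' : IsStarNormal (p.2.1 + star p.2.1) := (IsSelfAdjoint.add_star_self _).isStarNormal
  exact exists_isMultiplicity_of_projections dimProj_pos (P p.1 p.2) (U p.1 p.2)
    (fun k => isIdempotentElem_spectralProj κ _ _)
    ((Equiv.sum_comp ε _).trans (sum_spectralProj κ hn'))
    (fun k => (hp.1 k).trans_lt (by norm_num)) (fun k => (hp.2.1 k).trans_lt (by norm_num))
    fun e => hp.2.2 ⟨e, 0, dimProj_pos e⟩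

end Lifting

end NonstandardExtension

/-! ### Full matrix algebras and the final assembly -/

/-- Divisibility of dimension vectors for full matrix algebras. -/
theorem exists_isMultiplicity_iff_dvd {R : Type v} [CStarAlgebra R] [FiniteDimensional ℂ R]
    {S : Type*} [CStarAlgebra S] [FiniteDimensional ℂ S] {n N : ℕ} (hN : N ≠ 0)
    (φ : R ≃⋆ₐ[ℂ] Matrix (Fin n) (Fin n) ℂ) (ψ : S ≃⋆ₐ[ℂ] Matrix (Fin N) (Fin N) ℂ) :
    (∃ Γ : MinCentralProj R → MinCentralProj S → ℕ, IsMultiplicity (dimProj (R := R)) Γ) ↔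
      n ∣ N := by
  obtain ⟨f⟩ := nonempty_minCentralProj_of_matrix hN ψ
  have hf : ∀ f' : MinCentralProj S, f' = f := fun f' => Subtype.ext
    ((minCentralProj_eq_one_of_matrix ψ f').trans (minCentralProj_eq_one_of_matrix ψ f).symm)
  constructor
  · rintro ⟨Γ, h, -⟩
    rw [← dimProj_of_matrix ψ f, h f]
    exact Finset.dvd_sum fun e _ => Dvd.intro_left _ (by rw [dimProj_of_matrix φ e])
  · rintro ⟨c, rfl⟩
    obtain ⟨e⟩ := nonempty_minCentralProj_of_matrix (left_ne_zero_of_mul hN) φ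
    have he : ∀ e' : MinCentralProj R, e' = e := fun e' => Subtype.ext
      ((minCentralProj_eq_one_of_matrix φ e').trans (minCentralProj_eq_one_of_matrix φ e).symm)
    -- The inclusion matrix is 1 by 1, with the quotient as its entry; it is nonzero because `N` is.
    refine ⟨fun _ _ => c, fun f' => ?_, fun _ => ⟨f, right_ne_zero_of_mul hN⟩⟩
    rw [dimProj_of_matrix ψ, Finset.sum_eq_single e (fun e' _ h => absurd (he e') h) (by simp),
      dimProj_of_matrix φ, mul_comm]

namespace NonstandardExtension

variable {M : NonstandardExtension.{u}}

theorem std_dvd_iff (n : ℕ) (N : M.Ext ℕ) : M.std n ∣ N ↔ M.Holds (fun k => n ∣ k) N := by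
  constructor
  · rintro ⟨c, rfl⟩
    rw [mul_comm, ← M.map_id c, map_mul_std, holds_map]
    exact holds_of_forall (fun a => Dvd.intro_left a rfl) c
  · intro h
    refine ⟨M.map (fun k => k / n) N, ?_⟩
    rw [mul_comm, map_mul_std]
    conv_lhs => rw [← M.map_id N]
    exact (holds_eq _ _ _).1 (h.mono fun k hk => (Nat.div_mul_cancel hk).symm)

end NonstandardExtension

open NonstandardExtension in
theorem mainTheorem4 (M : NonstandardExtension.{u})
    -- the hyperfinite dimensional internal C⋆-algebra `𝔅 = M.Fiber B τ`
    {T : Type} (B : T → Type) [∀ t, CStarAlgebra (B t)] [∀ t, FiniteDimensional ℂ (B t)]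
    (τ : M.Ext T)
    -- the AF algebra `A`, the closure of the union of the `𝒜 i`
    {A : Type v} [CStarAlgebra A] (𝒜 : ℕ → StarSubalgebra ℂ A) (hmono : Monotone 𝒜)
    [∀ i, FiniteDimensional ℂ (𝒜 i)] (hdense : closure (⋃ i, (𝒜 i : Set A)) = Set.univ) :
    ((∃ φ : A →⋆ₐ[ℂ] M.Hull B τ, Function.Injective φ) ↔
      ∀ i, M.VecDvd (dimProj (R := 𝒜 i)) (M.dimVec τ B)) ∧
    (∀ (n : ℕ → ℕ) (N : M.Ext ℕ), N ≠ 0 →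
      (∀ i, Nonempty (𝒜 i ≃⋆ₐ[ℂ] Matrix (Fin (n i)) (Fin (n i)) ℂ)) →
      M.IsFullMatrixAlgebra τ B N →
      ((∃ φ : A →⋆ₐ[ℂ] M.Hull B τ, Function.Injective φ) ↔ ∀ i, M.std (n i) ∣ N)) := by
  -- Closedness makes each `𝒜 i` a C⋆-algebra in its own right.
  have hclosed : ∀ i, IsClosed (𝒜 i : Set A) := fun i =>
    Submodule.closed_of_finiteDimensional (Subalgebra.toSubmodule (𝒜 i).toSubalgebra)
  have main : (∃ φ : A →⋆ₐ[ℂ] M.Hull B τ, Function.Injective φ) ↔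
      ∀ i, M.VecDvd (dimProj (R := 𝒜 i)) (M.dimVec τ B) := by
    simp only [vecDvd_dimVec_iff]
    constructor
    · rintro ⟨φ, hφ⟩ i
      exact holds_isMultiplicity_of_injective (φ.comp (𝒜 i).subtype)
        (hφ.comp Subtype.val_injective)
    · intro h
      exact exists_injective_starAlgHom_hull hmono hdense fun i =>
        (h i).mono fun t ⟨Γ, hΓ⟩ => exists_starAlgHom_of_isMultiplicity hΓ
  refine ⟨main, fun n N hN hA hB => main.trans (forall_congr' fun i => ?_)⟩
  obtain ⟨φ⟩ := hA i
  rw [vecDvd_dimVec_iff, std_dvd_iff]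
  -- All statements are moved to the single point `(τ, N)`, where they can be compared fibre by
  -- fibre.
  have hN' : M.Holds (fun p : T × ℕ => p.2 ≠ 0) (M.pair τ N) := by
    rw [← map_ne_zero_iff_holds, M.map_snd_pair]
    exact hN
  have h₁ := holds_map (M := M) (fun k => n i ∣ k) Prod.snd (M.pair τ N)
  have h₂ := holds_map (M := M) (fun t => ∃ Γ : MinCentralProj (𝒜 i) → MinCentralProj (B t) → ℕ,
    IsMultiplicity (dimProj (R := 𝒜 i)) Γ) Prod.fst (M.pair τ N)
  rw [M.map_snd_pair] at h₁
  rw [M.map_fst_pair] at h₂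
  rw [h₁, h₂]
  have h := (holds_and _ _ _).2 ⟨hN', hB⟩
  constructor
  · exact fun h' => h.mono₂ h' fun p ⟨h0, ⟨ψ⟩⟩ hΓ => (exists_isMultiplicity_iff_dvd h0 φ ψ).1 hΓ
  · exact fun h' => h.mono₂ h' fun p ⟨h0, ⟨ψ⟩⟩ hd => (exists_isMultiplicity_iff_dvd h0 φ ψ).2 hd
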